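/- Let $\omega_a,\omega_b,\delta\in\mathbb R$, $\kappa\in\mathbb C$, $\eta=\omega_a+\omega_b+\delta$, and consider on the two-mode Fock space (annihilation operators $a,b$) the parametric amplifier Hamiltonian $$H(t)=\omega_a a^\dagger a+\omega_b b^\dagger b+\kappa\,ab\,e^{i\eta t}+\kappa^*a^\dagger b^\dagger e^{-i\eta t}.$$ It has a unique time-evolution operator: there is exactly one family of unitary operators $U(t)$, $t\in\mathbb R$, with $U(0)=1$ and $\frac{d}{dt}\langle f,U(t)\psi\rangle=-i\langle H(t)f,U(t)\psi\rangle$ for every state $\psi$ and every finite linear combination $f$ of number states. Let $\bar n_a,\bar n_b>0$ and let the initial state be the two-mode thermal state $$\rho(0)=\frac1{\bar n_a\bar n_b}\int_{\mathbb C^2}\frac{d^2\zeta_a\,d^2\zeta_b}{\pi^2}\,e^{-(|\zeta_a|^2/\bar n_a+|\zeta_b|^2/\bar n_b)}\,|\zeta_a,\zeta_b\rangle\langle\zeta_a,\zeta_b|,$$ where $|\zeta_a,\zeta_b\rangle$ are the coherent states. Put $\rho(t)=U(t)\rho(0)U(t)^\dagger$, let $\mathscr H(\alpha,\beta;t)=\langle\alpha,\beta|\rho(t)|\alpha,\beta\rangle$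 be its Husimi function, and let $\mathscr H^{A}(\alpha;t)=\int\frac{d^2\beta}{\pi}\mathscr H(\alpha,\beta;t)$ and $\mathscr H^{B}(\beta;t)=\int\frac{d^2\alpha}{\pi}\mathscr H(\alpha,\beta;t)$ be the marginals. The joint and partial Wehrl entropies are $$E[\mathscr H;t]=-\int\frac{d^2\alpha\,d^2\beta}{\pi^2}\,\mathscr H\ln\mathscr H,\qquad E[\mathscr H^{A};t]=-\int\frac{d^2\alpha}{\pi}\,\mathscr H^{A}\ln\mathscr H^{A},\qquad E[\mathscr H^{B};t]=-\int\frac{d^2\beta}{\pi}\,\mathscr H^{B}\ln\mathscr H^{B}.$$ With $\varphi=[|\kappa|^2-(\delta/2)^2]^{1/2}$ (real or imaginary; $\sinh(\varphi t)/\varphi$ means $t$ if $\varphi=0$) set $$G(x,y;t)=(\bar n_a x+1)(\bar n_b y+1)+(\bar n_a+\bar n_b+1)\,(|\kappa|/\varphi)^2\sinh^2(\varphi t),$$ $$\ell_a=\frac{G(1,0;t)}{G(1,1;t)},\qquad \ell_b=\frac{G(0,1;t)}{G(1,1;t)},$$ $$\ell_{ab}=i\frac{\kappa}{\varphi}\sinh(\varphi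 t)\Bigl[\cosh(\varphi t)-\frac{i\delta}{2\varphi}\sinh(\varphi t)\Bigr]\frac{\bar n_a+\bar n_b+1}{G(1,1;t)}\,e^{i(\omega_a+\omega_b+\delta)t}.$$ Then for every real $t$ (in particular $t\ge 0$) the following hold, all integrals involved being absolutely convergent. 1. For all $\alpha,\beta\in\mathbb C$, $\mathscr H(\alpha,\beta;t)=G(1,1;t)^{-1}\,e^{-(\ell_b|\alpha|^2+\ell_a|\beta|^2)}\,e^{2\,\mathrm{Re}(\ell_{ab}\alpha\beta)}$. 2. $\mathscr H^{A}(\alpha;t)=G(1,0;t)^{-1}e^{-|\alpha|^2/G(1,0;t)}$ and $\mathscr H^{B}(\beta;t)=G(0,1;t)^{-1}e^{-|\beta|^2/G(0,1;t)}$ for all $\alpha,\beta\in\mathbb C$. 3. $E[\mathscr H;t]=2+\ln G(1,1;t)$, $\;E[\mathscr H^{A};t]=1+\ln G(1,0;t)$, $\;E[\mathscr H^{B};t]=1+\ln G(0,1;t)$. 4. (Subadditivity) $E[\mathscr H;t]\le E[\mathscr H^{A};t]+E[\mathscr H^{B};t]$. At $t=0$ equality holds, and $\mathscr H(\alpha,\beta;0)=\mathscr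 H^{A}(\alpha;0)\,\mathscr H^{B}(\beta;0)$ for all $\alpha,\beta\in\mathbb C$. -/

import Mathlib

open MeasureTheory

noncomputable section

namespace ParamAmp

/-! ### The two-mode Fock space -/

/-- The Hilbert space of two bosonic modes, `ℓ²(ℕ × ℕ)`: the orthonormal number basis `|m, n⟩`
is indexed by the occupation numbers `(m, n)` of the modes `a` and `b`. -/
abbrev Fock : Type := lp (fun _ : ℕ × ℕ => ℂ) 2

/-- Finite linear combinations of number states, the common invariant domain of `a`, `b`, `a†`,
`b†`. -/
abbrev FiniteStates : Type := ℕ × ℕ →₀ ℂ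

/-- The inclusion of the finite linear combinations of number states into the Fock space. -/
def toFock : FiniteStates →ₗ[ℂ] Fock :=
  Finsupp.linearCombination ℂ (fun p : ℕ × ℕ => (lp.single 2 p (1 : ℂ) : Fock))

/-- `a |m, n⟩ = √m |m - 1, n⟩`. -/
def annA : Module.End ℂ FiniteStates :=
  Finsupp.linearCombination ℂ
    (fun p : ℕ × ℕ => Finsupp.single (p.1 - 1, p.2) ((Real.sqrt p.1 : ℝ) : ℂ))

/-- `a† |m, n⟩ = √(m + 1) |m + 1, n⟩`. -/
def creA : Module.End ℂ FiniteStates :=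
  Finsupp.linearCombination ℂ
    (fun p : ℕ × ℕ => Finsupp.single (p.1 + 1, p.2) ((Real.sqrt (p.1 + 1) : ℝ) : ℂ))

/-- `b |m, n⟩ = √n |m, n - 1⟩`. -/
def annB : Module.End ℂ FiniteStates :=
  Finsupp.linearCombination ℂ
    (fun p : ℕ × ℕ => Finsupp.single (p.1, p.2 - 1) ((Real.sqrt p.2 : ℝ) : ℂ))

/-- `b† |m, n⟩ = √(n + 1) |m, n + 1⟩`. -/
def creB : Module.End ℂ FiniteStates :=
  Finsupp.linearCombination ℂ
    (fun p : ℕ × ℕ => Finsupp.single (p.1, p.2 + 1) ((Real.sqrt (p.2 + 1) : ℝ) : ℂ))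

/-! ### Parametric amplifier -/

/-- The data of a parametric amplifier: mode frequencies, detuning and complex coupling. -/
structure Amplifier where
  ωa : ℝ
  ωb : ℝ
  δ : ℝ
  κ : ℂ

/-- The pump frequency `η = ωa + ωb + δ`. -/
def Amplifier.η (P : Amplifier) : ℝ := P.ωa + P.ωb + P.δ

/-- `H(t) = ωa a†a + ωb b†b + κ a b e^{iηt} + κ* a†b† e^{-iηt}` (with `ħ = 1`). -/
def Amplifier.hamiltonian (P : Amplifier) (t : ℝ) : Module.End ℂ FiniteStates :=
  (P.ωa : ℂ) • (creA * annA) + (P.ωb : ℂ) • (creB * annB)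
    + (P.κ * Complex.exp (Complex.I * P.η * t)) • (annA * annB)
    + (starRingEnd ℂ P.κ * Complex.exp (-(Complex.I * P.η * t))) • (creA * creB)

/-- `U` is the time-evolution operator of `H(t)`: a family of unitary operators on the Fock space
with `U(0) = 1` that solves the Schrödinger equation `i dU/dt = H(t) U`, tested against the finite
linear combinations `f` of number states:
`d/dt ⟨f, U(t) ψ⟩ = -i ⟨H(t) f, U(t) ψ⟩` for every state `ψ`. -/
structure Amplifier.IsTimeEvolution (P : Amplifier) (U : ℝ → Fock →L[ℂ] Fock) : Prop where
  isUnitary : ∀ t : ℝ, U t ∈ unitary (Fock →L[ℂ] Fock)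
  initial : U 0 = 1
  schrodinger : ∀ (ψ : Fock) (f : FiniteStates) (t : ℝ),
    HasDerivAt (fun s : ℝ => inner ℂ (toFock f) (U s ψ))
      (-Complex.I * inner ℂ (toFock (P.hamiltonian t f)) (U t ψ)) t

/-! ### Coherent states, thermal states -/

/-- The number-basis coefficients of `|α, β⟩ = |α⟩ ⊗ |β⟩`, where
`|ζ⟩ = e^{-|ζ|²/2} ∑ₙ ζⁿ / √(n!) |n⟩`. -/
def coherentCoeff (α β : ℂ) (p : ℕ × ℕ) : ℂ :=
  ((Real.exp (-‖α‖ ^ 2 / 2) : ℝ) : ℂ) * (α ^ p.1 / ((Real.sqrt (p.1.factorial) : ℝ) : ℂ))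
    * (((Real.exp (-‖β‖ ^ 2 / 2) : ℝ) : ℂ) * (β ^ p.2 / ((Real.sqrt (p.2.factorial) : ℝ) : ℂ)))

theorem coherentCoeff_memℓp (α β : ℂ) :
    Memℓp (fun p : ℕ × ℕ => coherentCoeff α β p) 2 := by
  apply memℓp_gen
  have h := ((Real.summable_pow_div_factorial (‖α‖ ^ 2)).mul_of_nonneg
    (Real.summable_pow_div_factorial (‖β‖ ^ 2)) (fun n => by positivity)
    (fun n => by positivity)).mul_left
    (Real.exp (-‖α‖ ^ 2 / 2) ^ 2 * Real.exp (-‖β‖ ^ 2 / 2) ^ 2)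
  refine h.congr fun p => ?_
  have e1 : Real.sqrt (p.1.factorial : ℝ) ^ 2 = p.1.factorial := Real.sq_sqrt (by positivity)
  have e2 : Real.sqrt (p.2.factorial : ℝ) ^ 2 = p.2.factorial := Real.sq_sqrt (by positivity)
  simp only [coherentCoeff, norm_mul, norm_div, norm_pow, Complex.norm_real, Real.norm_eq_abs,
    abs_of_nonneg (Real.sqrt_nonneg _), Real.abs_exp, ENNReal.toReal_ofNat, Real.rpow_ofNat,
    mul_pow, div_pow, e1, e2, ← pow_mul, mul_comm 2]
  ring

/-- The two-mode coherent state `|α, β⟩`. -/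
def coherent (α β : ℂ) : Fock := ⟨fun p => coherentCoeff α β p, coherentCoeff_memℓp α β⟩

/-- The thermal density operator with mean occupation numbers `na`, `nb`, in its expansion
`(na nb)⁻¹ ∫ d²ζa d²ζb / π² e^{-(|ζa|²/na + |ζb|²/nb)} |ζa, ζb⟩⟨ζa, ζb|`
(a Bochner integral of rank-one projectors in the operator norm). -/
def thermalState (na nb : ℝ) : Fock →L[ℂ] Fock :=
  (1 / (na * nb)) • ∫ ζ : ℂ × ℂ,
    (Real.exp (-(na⁻¹ * ‖ζ.1‖ ^ 2 + nb⁻¹ * ‖ζ.2‖ ^ 2)) / Real.pi ^ 2) •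
      InnerProductSpace.rankOne ℂ (coherent ζ.1 ζ.2) (coherent ζ.1 ζ.2)

/-- The Schrödinger evolution `ρ(t) = U(t) ρ(0) U(t)†` for the value `V = U(t)`. -/
def evolve (V ρ : Fock →L[ℂ] Fock) : Fock →L[ℂ] Fock := V * ρ * star V

/-! ### Husimi functions and entropies -/

/-- The Husimi function `⟨α, β| ρ |α, β⟩` (a real number when `ρ` is self-adjoint). -/
def husimi (ρ : Fock →L[ℂ] Fock) (α β : ℂ) : ℝ :=
  (inner ℂ (coherent α β) (ρ (coherent α β))).re

/-- Marginal Husimi function of mode `a`. -/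
def marginalA (Q : ℂ → ℂ → ℝ) (α : ℂ) : ℝ := ∫ β : ℂ, Q α β / Real.pi

/-- Marginal Husimi function of mode `b`. -/
def marginalB (Q : ℂ → ℂ → ℝ) (β : ℂ) : ℝ := ∫ α : ℂ, Q α β / Real.pi

/-- The joint Wehrl entropy. -/
def jointEntropy (Q : ℂ → ℂ → ℝ) : ℝ :=
  -∫ z : ℂ × ℂ, Q z.1 z.2 * Real.log (Q z.1 z.2) / Real.pi ^ 2

/-- The Wehrl entropy of one mode. -/
def partialEntropy (q : ℂ → ℝ) : ℝ := -∫ z : ℂ, q z * Real.log (q z) / Real.pi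

/-! ### The functions in the closed forms -/

/-- `φ = (|κ|² - (δ/2)²)^{1/2}`, real or purely imaginary. -/
def Amplifier.φ (P : Amplifier) : ℂ := ((‖P.κ‖ ^ 2 - (P.δ / 2) ^ 2 : ℝ) : ℂ) ^ (1 / 2 : ℂ)

/-- `sinh(φt) / φ`, with its continuous value `t` at `φ = 0`. It is real for all parameters. -/
def Amplifier.sinhRatio (P : Amplifier) (t : ℝ) : ℂ :=
  if P.φ = 0 then (t : ℂ) else Complex.sinh (P.φ * t) / P.φ

/-- `G(x, y; t) = (na x + 1)(nb y + 1) + (na + nb + 1) (|κ|/φ)² sinh²(φt)`. -/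
def Amplifier.G (P : Amplifier) (na nb x y t : ℝ) : ℝ :=
  (na * x + 1) * (nb * y + 1) + (na + nb + 1) * (‖P.κ‖ ^ 2 * (P.sinhRatio t ^ 2).re)

def Amplifier.ℓa (P : Amplifier) (na nb t : ℝ) : ℝ := P.G na nb 1 0 t / P.G na nb 1 1 t

def Amplifier.ℓb (P : Amplifier) (na nb t : ℝ) : ℝ := P.G na nb 0 1 t / P.G na nb 1 1 t

/-- `ℓab = i (κ/φ) sinh(φt) [cosh(φt) - i (δ/2φ) sinh(φt)] (na + nb + 1) G(1,1;t)⁻¹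
e^{i(ωa + ωb + δ)t}`. -/
def Amplifier.ℓab (P : Amplifier) (na nb t : ℝ) : ℂ :=
  Complex.I * P.κ * P.sinhRatio t
    * (Complex.cosh (P.φ * t) - Complex.I * (P.δ / 2) * P.sinhRatio t)
    * (na + nb + 1) * ((P.G na nb 1 1 t)⁻¹ : ℝ)
    * Complex.exp (Complex.I * (P.ωa + P.ωb + P.δ) * t)

end ParamAmp

end

/-!
A path `c : ℝ → Fock` solves the Schrödinger equation tested against number states if and only if
its number-basis coefficients solve an infinite system of ordinary differential equations that
couples `(m, n)` only to `(m ± 1, n ± 1)`, with coefficients of linear growth. Such a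
Jacobi-type system conserves the norm of every locally bounded solution
(`Amplifier.IsWeakSolution.norm_eq`): this is Carleman's argument, with a logarithmic cut-off of
the number basis whose increments beat the growth of the coefficients. Hence locally bounded weak
solutions are determined by their value at one time, which gives uniqueness of the time-evolution
operator.

For existence, the evolution of the coherent state `|ζ, ξ⟩` is written down explicitly. In
Bargmann's representation it is `N exp (A z w + B z + C w)`; the Schrödinger equation becomes a
Riccati equation for `A` with `‖A t‖ < 1` and linear equations for `B`, `C`, `log N`, all solved by
`cosh (φ t)` and `sinh (φ t) / φ` (`Amplifier.cohEvol`, `Amplifier.isWeakSolution_cohEvol`). Norm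
conservation makes the induced map on finite combinations of coherent states isometric, coherent
states are total, and so the map extends to an isometry of Fock space. It is surjective because the
amplifier translated in time is again an amplifier (`Amplifier.evolution_surjective`).

By uniqueness every time-evolution operator maps `|ζ, ξ⟩` to `Amplifier.cohEvol`, so
`⟨α, β| U(t) |ζ, ξ⟩` is an explicit Gaussian, and averaging its squared modulus over the thermal
weight is a Gaussian integral over `ℂ × ℂ` (`integral_gaussExponent`,
`Amplifier.IsTimeEvolution.husimi_eq`). The marginals are Gaussian integrals again, and the
entropies follow from Euler's identity `∫ q exp (-q) = (d / 2) ∫ exp (-q)` for a positive quadratic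
form in real dimension `d`. Subadditivity is the inequality `G(1,1) ≤ G(1,0) G(0,1)`
(`Amplifier.G_mul_G`), whose defect vanishes at `t = 0`.
-/

namespace ParamAmp

/-! ### The Schrödinger equation in the number basis -/

/-- The time-dependent coupling `κ e^{iηt}`. -/
noncomputable def Amplifier.coupling (P : Amplifier) (t : ℝ) : ℂ :=
  P.κ * Complex.exp (Complex.I * P.η * t)

/-- The `p`-th number-basis coefficient of `-i H(t) c`, for an arbitrary family of
coefficients `c`. At `p.1 = 0` or `p.2 = 0` the truncated subtraction is harmless, because the
corresponding square root vanishes. -/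
noncomputable def Amplifier.generator (P : Amplifier) (t : ℝ) (c : ℕ × ℕ → ℂ) (p : ℕ × ℕ) : ℂ :=
  -Complex.I * ((P.ωa * p.1 + P.ωb * p.2) * c p
    + P.coupling t * ((√(p.1 + 1) * √(p.2 + 1) : ℝ) : ℂ) * c (p.1 + 1, p.2 + 1)
    + starRingEnd ℂ (P.coupling t) * ((√p.1 * √p.2 : ℝ) : ℂ) * c (p.1 - 1, p.2 - 1))

/-- A path in Fock space solving the Schrödinger equation coefficient by coefficient. -/
def Amplifier.IsWeakSolution (P : Amplifier) (c : ℝ → Fock) : Prop :=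
  ∀ (p : ℕ × ℕ) (t : ℝ), HasDerivAt (fun s => c s p) (P.generator t (c t) p) t

/-- Boundedness in norm on every compact time interval. -/
def LocallyBounded (c : ℝ → Fock) : Prop :=
  ∀ T : ℝ, ∃ M : ℝ, ∀ s : ℝ, |s| ≤ T → ‖c s‖ ≤ M

theorem inner_toFock_single (p : ℕ × ℕ) (a : ℂ) (x : Fock) :
    inner ℂ (toFock (Finsupp.single p a)) x = starRingEnd ℂ a * x p := by
  simp [toFock, Finsupp.linearCombination_single, lp.inner_single_left, mul_comm]

theorem Amplifier.norm_coupling (P : Amplifier) (t : ℝ) : ‖P.coupling t‖ = ‖P.κ‖ := by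
  have : Complex.I * P.η * t = ((P.η * t : ℝ) : ℂ) * Complex.I := by push_cast; ring
  rw [coupling, norm_mul, this, Complex.norm_exp_ofReal_mul_I, mul_one]

theorem Amplifier.conj_coupling (P : Amplifier) (t : ℝ) :
    starRingEnd ℂ (P.coupling t)
      = starRingEnd ℂ P.κ * Complex.exp (-(Complex.I * P.η * t)) := by
  rw [coupling, map_mul, ← Complex.exp_conj]
  simp

theorem creA_annA_single (p : ℕ × ℕ) (a : ℂ) :
    (creA * annA) (Finsupp.single p a) = Finsupp.single p (p.1 * a) := by
  obtain ⟨m, n⟩ := p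
  have h : ((√(m : ℝ) : ℝ) : ℂ) * ((√(m : ℝ) : ℝ) : ℂ) = m := by
    rw [← Complex.ofReal_mul, Real.mul_self_sqrt (by positivity)]; simp
  rcases m with _ | m
  · simp [creA, annA, Finsupp.linearCombination_single]
  · simp only [creA, annA, Module.End.mul_apply, Finsupp.linearCombination_single,
      Finsupp.smul_single, smul_eq_mul, Nat.add_sub_cancel]
    push_cast at h ⊢
    congr 1
    linear_combination a * h

theorem creB_annB_single (p : ℕ × ℕ) (a : ℂ) :
    (creB * annB) (Finsupp.single p a) = Finsupp.single p (p.2 * a) := by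
  obtain ⟨m, n⟩ := p
  have h : ((√(n : ℝ) : ℝ) : ℂ) * ((√(n : ℝ) : ℝ) : ℂ) = n := by
    rw [← Complex.ofReal_mul, Real.mul_self_sqrt (by positivity)]; simp
  rcases n with _ | n
  · simp [creB, annB, Finsupp.linearCombination_single]
  · simp only [creB, annB, Module.End.mul_apply, Finsupp.linearCombination_single,
      Finsupp.smul_single, smul_eq_mul, Nat.add_sub_cancel]
    push_cast at h ⊢
    congr 1
    linear_combination a * h

theorem annA_annB_single (p : ℕ × ℕ) (a : ℂ) :
    (annA * annB) (Finsupp.single p a)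
      = Finsupp.single (p.1 - 1, p.2 - 1) (((√p.1 * √p.2 : ℝ) : ℂ) * a) := by
  simp only [annA, annB, Module.End.mul_apply, Finsupp.linearCombination_single,
      Finsupp.smul_single, smul_eq_mul]
  congr 1
  push_cast
  ring

theorem creA_creB_single (p : ℕ × ℕ) (a : ℂ) :
    (creA * creB) (Finsupp.single p a)
      = Finsupp.single (p.1 + 1, p.2 + 1) (((√(p.1 + 1) * √(p.2 + 1) : ℝ) : ℂ) * a) := by
  simp only [creA, creB, Module.End.mul_apply, Finsupp.linearCombination_single,
      Finsupp.smul_single, smul_eq_mul]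
  congr 1
  push_cast
  ring

theorem Amplifier.inner_hamiltonian_single (P : Amplifier) (t : ℝ) (p : ℕ × ℕ) (a : ℂ)
    (x : Fock) :
    -Complex.I * inner ℂ (toFock (P.hamiltonian t (Finsupp.single p a))) x
      = starRingEnd ℂ a * P.generator t x p := by
  simp only [hamiltonian, LinearMap.add_apply, LinearMap.smul_apply, creA_annA_single,
    creB_annB_single, annA_annB_single, creA_creB_single, Finsupp.smul_single, smul_eq_mul,
    map_add, inner_add_left, inner_toFock_single]
  rw [← P.conj_coupling, ← coupling]
  simp only [map_mul, Complex.conj_conj, Complex.conj_ofReal, map_natCast, generator]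
  ring

/-- The Schrödinger equation tested against finite linear combinations of number states is
equivalent to its coefficientwise form. -/
theorem Amplifier.isWeakSolution_iff (P : Amplifier) (c : ℝ → Fock) :
    P.IsWeakSolution c ↔ ∀ (f : FiniteStates) (t : ℝ),
      HasDerivAt (fun s : ℝ => inner ℂ (toFock f) (c s))
        (-Complex.I * inner ℂ (toFock (P.hamiltonian t f)) (c t)) t := by
  constructor
  · intro h f t
    induction f using Finsupp.induction_linear with
    | zero => simpa using hasDerivAt_const t (0 : ℂ)
    | add f g hf hg =>
      simp only [map_add, inner_add_left, mul_add]
      exact hf.add hg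
    | single p a =>
      simp only [P.inner_hamiltonian_single, inner_toFock_single]
      exact (h p t).const_mul _
  · intro h p t
    have := h (Finsupp.single p 1) t
    simpa only [P.inner_hamiltonian_single, inner_toFock_single, map_one, one_mul] using this

theorem Amplifier.generator_add (P : Amplifier) (t : ℝ) (c d : ℕ × ℕ → ℂ) (p : ℕ × ℕ) :
    P.generator t (c + d) p = P.generator t c p + P.generator t d p := by
  simp only [generator, Pi.add_apply]; ring

theorem Amplifier.generator_smul (P : Amplifier) (t : ℝ) (a : ℂ) (c : ℕ × ℕ → ℂ) (p : ℕ × ℕ) :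
    P.generator t (a • c) p = a * P.generator t c p := by
  simp only [generator, Pi.smul_apply, smul_eq_mul]; ring

theorem Amplifier.IsWeakSolution.add {P : Amplifier} {c d : ℝ → Fock}
    (hc : P.IsWeakSolution c) (hd : P.IsWeakSolution d) :
    P.IsWeakSolution (fun t => c t + d t) := fun p t => by
  simpa only [lp.coeFn_add, P.generator_add, Pi.add_apply] using (hc p t).fun_add (hd p t)

theorem Amplifier.IsWeakSolution.const_smul {P : Amplifier} {c : ℝ → Fock}
    (hc : P.IsWeakSolution c) (a : ℂ) : P.IsWeakSolution (fun t => a • c t) := fun p t => by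
  simpa only [lp.coeFn_smul, P.generator_smul, Pi.smul_apply, smul_eq_mul]
    using (hc p t).const_mul a

theorem LocallyBounded.add {c d : ℝ → Fock} (hc : LocallyBounded c) (hd : LocallyBounded d) :
    LocallyBounded (fun t => c t + d t) := fun T => by
  obtain ⟨M, hM⟩ := hc T
  obtain ⟨N, hN⟩ := hd T
  exact ⟨M + N, fun s hs => (norm_add_le _ _).trans (add_le_add (hM s hs) (hN s hs))⟩

theorem LocallyBounded.const_smul {c : ℝ → Fock} (hc : LocallyBounded c) (a : ℂ) :
    LocallyBounded (fun t => a • c t) := fun T => by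
  obtain ⟨M, hM⟩ := hc T
  refine ⟨‖a‖ * M, fun s hs => ?_⟩
  rw [norm_smul]
  exact mul_le_mul_of_nonneg_left (hM s hs) (norm_nonneg a)

/-! ### Conservation of the norm of weak solutions -/

theorem Fock.hasSum_norm_sq (x : Fock) : HasSum (fun p => ‖x p‖ ^ 2) (‖x‖ ^ 2) := by
  simpa using lp.hasSum_norm (by simp : 0 < (2 : ENNReal).toReal) x

theorem Fock.sum_norm_sq_comp_le (x : Fock) (s : Finset (ℕ × ℕ)) {e : ℕ × ℕ → ℕ × ℕ}
    (he : Function.Injective e) : ∑ p ∈ s, ‖x (e p)‖ ^ 2 ≤ ‖x‖ ^ 2 := by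
  classical
  rw [← Finset.sum_image (f := fun p => ‖x p‖ ^ 2) (fun a _ b _ h => he h)]
  exact sum_le_hasSum _ (fun _ _ => by positivity) (Fock.hasSum_norm_sq x)

/-- Logarithmic cut-off in the number basis: it is finitely supported, tends to `1` as `ε → 0`,
and varies so slowly that its increments beat the linear growth of the Hamiltonian. -/
noncomputable def cutoff (ε : ℝ) (p : ℕ × ℕ) : ℝ := max 0 (1 - ε * Real.log (1 + p.1 + p.2))

theorem cutoff_nonneg (ε : ℝ) (p : ℕ × ℕ) : 0 ≤ cutoff ε p := le_max_left _ _

theorem cutoff_le_one {ε : ℝ} (hε : 0 ≤ ε) (p : ℕ × ℕ) : cutoff ε p ≤ 1 := by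
  have : 0 ≤ Real.log (1 + p.1 + p.2) := Real.log_nonneg (by
    have : (0 : ℝ) ≤ p.1 := by positivity
    have : (0 : ℝ) ≤ p.2 := by positivity
    linarith)
  exact max_le zero_le_one (by nlinarith)

theorem cutoff_eq_zero {ε : ℝ} (hε : 0 < ε) {p : ℕ × ℕ}
    (hp : Real.exp (1 / ε) ≤ 1 + p.1 + p.2) : cutoff ε p = 0 := by
  have h : 1 / ε ≤ Real.log (1 + p.1 + p.2) :=
    (Real.le_log_iff_exp_le (by positivity)).mpr hp
  rw [div_le_iff₀ hε] at h
  exact max_eq_left (by linarith)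

theorem abs_cutoff_sub_mul_le {ε : ℝ} (hε : 0 ≤ ε) (p : ℕ × ℕ) :
    |cutoff ε p - cutoff ε (p.1 + 1, p.2 + 1)| * (√(p.1 + 1) * √(p.2 + 1)) ≤ 2 * ε := by
  obtain ⟨m, n⟩ := p
  have hm : (0 : ℝ) ≤ m := by positivity
  have hn : (0 : ℝ) ≤ n := by positivity
  set s : ℝ := 1 + m + n with hs
  have hs1 : 0 < s := by positivity
  have e3 : (1 : ℝ) + ((m + 1 : ℕ) : ℝ) + ((n + 1 : ℕ) : ℝ) = s + 2 := by push_cast; ring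
  have h1 : |cutoff ε (m, n) - cutoff ε (m + 1, n + 1)| ≤ ε * (2 / s) := by
    simp only [cutoff, e3, ← hs]
    have hmono : Real.log s ≤ Real.log (s + 2) := Real.log_le_log hs1 (by linarith)
    have hle : Real.log (s + 2) - Real.log s ≤ 2 / s := by
      rw [← Real.log_div (by positivity) (by positivity)]
      have := Real.log_le_sub_one_of_pos (show 0 < (s + 2) / s by positivity)
      have e : (s + 2) / s - 1 = 2 / s := by field_simp; ring
      linarith
    rw [max_comm 0, max_comm 0]
    refine (abs_max_sub_max_le_abs _ _ _).trans ?_ |>.trans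
      (mul_le_mul_of_nonneg_left hle hε)
    rw [abs_le]
    constructor <;> nlinarith
  have h2 : √((m : ℝ) + 1) * √((n : ℝ) + 1) ≤ s := by
    have a1 := Real.sq_sqrt (show (0 : ℝ) ≤ m + 1 by positivity)
    have a2 := Real.sq_sqrt (show (0 : ℝ) ≤ n + 1 by positivity)
    nlinarith [sq_nonneg (√((m : ℝ) + 1) - √((n : ℝ) + 1))]
  calc _ ≤ ε * (2 / s) * s := mul_le_mul h1 h2 (by positivity) (by positivity)
    _ = 2 * ε := by field_simp

theorem sum_range_eq_sum_range_succ {f : ℕ → ℝ} {L : ℕ} (h0 : f 0 = 0) (hL : f L = 0) :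
    ∑ i ∈ Finset.range L, f i = ∑ i ∈ Finset.range L, f (i + 1) := by
  have h1 := Finset.sum_range_succ f L
  rw [Finset.sum_range_succ', h0, hL] at h1
  linarith

/-- Twice the imaginary part of the coupling of the coefficients at `p` and `p + (1, 1)`: the
probability current between these two sites. -/
noncomputable def Amplifier.current (P : Amplifier) (t : ℝ) (c : ℕ × ℕ → ℂ) (p : ℕ × ℕ) : ℝ :=
  2 * (P.coupling t * ((√(p.1 + 1) * √(p.2 + 1) : ℝ) : ℂ)
    * (starRingEnd ℂ (c p) * c (p.1 + 1, p.2 + 1))).im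

/-- Summation by parts: the rate of change of a finitely supported weighted norm only involves the
increments of the weight along the couplings. The diagonal part of the Hamiltonian drops out. -/
theorem Amplifier.sum_cutoff_mul_re_generator (P : Amplifier) (t : ℝ) (c : ℕ × ℕ → ℂ)
    (g : ℕ × ℕ → ℝ) {L : ℕ} (hg : ∀ p : ℕ × ℕ, L ≤ p.1 ∨ L ≤ p.2 → g p = 0) :
    ∑ p ∈ Finset.range L ×ˢ Finset.range L,
        g p * (2 * (starRingEnd ℂ (c p) * P.generator t c p).re)
      = ∑ p ∈ Finset.range L ×ˢ Finset.range L,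
        (g p - g (p.1 + 1, p.2 + 1)) * P.current t c p := by
  -- the inflow at `p` is the outflow at `p - (1, 1)`, hence a shift of the summation index
  set F : ℕ → ℕ → ℝ := fun m n => g (m, n) * (2 * (starRingEnd ℂ (P.coupling t)
    * ((√m * √n : ℝ) : ℂ) * (starRingEnd ℂ (c (m, n)) * c (m - 1, n - 1))).im) with hF
  have h1 : ∀ p : ℕ × ℕ, g p * (2 * (starRingEnd ℂ (c p) * P.generator t c p).re)
      = g p * P.current t c p + F p.1 p.2 := by
    intro p
    have hre : ∀ z : ℂ, (-Complex.I * z).re = z.im := by intro z; simp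
    have e : starRingEnd ℂ (c p) * P.generator t c p = -Complex.I *
        (((P.ωa * p.1 + P.ωb * p.2 : ℝ) : ℂ) * ((Complex.normSq (c p) : ℝ) : ℂ)
        + (P.coupling t * ((√(p.1 + 1) * √(p.2 + 1) : ℝ) : ℂ)
          * (starRingEnd ℂ (c p) * c (p.1 + 1, p.2 + 1)))
        + (starRingEnd ℂ (P.coupling t) * ((√p.1 * √p.2 : ℝ) : ℂ)
          * (starRingEnd ℂ (c p) * c (p.1 - 1, p.2 - 1)))) := by
      rw [Complex.normSq_eq_conj_mul_self, generator]
      push_cast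
      ring
    rw [e, hre, hF, current]
    simp only [Complex.add_im, ← Complex.ofReal_mul, Complex.ofReal_im]
    ring
  have h2 : ∀ m n, F (m + 1) (n + 1) = -(g (m + 1, n + 1) * P.current t c (m, n)) := by
    intro m n
    have e : (starRingEnd ℂ (P.coupling t) * ((√((m + 1 : ℕ) : ℝ) * √((n + 1 : ℕ) : ℝ) : ℝ) : ℂ)
        * (starRingEnd ℂ (c (m + 1, n + 1)) * c (m + 1 - 1, n + 1 - 1)))
        = starRingEnd ℂ (P.coupling t * ((√((m : ℝ) + 1) * √((n : ℝ) + 1) : ℝ) : ℂ)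
          * (starRingEnd ℂ (c (m, n)) * c (m + 1, n + 1))) := by
      simp only [map_mul, Complex.conj_conj, Complex.conj_ofReal, Nat.add_sub_cancel]
      push_cast
      ring
    simp only [hF]
    rw [e, Complex.conj_im, current]
    ring
  have h3 : ∑ m ∈ Finset.range L, ∑ n ∈ Finset.range L, F m n
      = ∑ m ∈ Finset.range L, ∑ n ∈ Finset.range L, F (m + 1) (n + 1) := by
    rw [sum_range_eq_sum_range_succ (f := fun m => ∑ n ∈ Finset.range L, F m n)
      (Finset.sum_eq_zero fun n _ => by simp [hF])
      (Finset.sum_eq_zero fun n _ => by simp only [hF]; rw [hg (L, n) (Or.inl le_rfl), zero_mul])]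
    refine Finset.sum_congr rfl fun m _ => ?_
    exact sum_range_eq_sum_range_succ (by simp [hF])
      (by simp only [hF]; rw [hg (m + 1, L) (Or.inr le_rfl), zero_mul])
  rw [Finset.sum_congr rfl fun p _ => h1 p, Finset.sum_add_distrib,
    Finset.sum_product (f := fun p : ℕ × ℕ => F p.1 p.2), h3,
    ← Finset.sum_product (f := fun p : ℕ × ℕ => F (p.1 + 1) (p.2 + 1)), ← Finset.sum_add_distrib]
  refine Finset.sum_congr rfl fun p _ => ?_
  rw [h2]
  ring

theorem Amplifier.abs_sum_cutoff_current_le (P : Amplifier) (t : ℝ) (x : Fock) {ε : ℝ}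
    (hε : 0 ≤ ε) (s : Finset (ℕ × ℕ)) :
    |∑ p ∈ s, (cutoff ε p - cutoff ε (p.1 + 1, p.2 + 1)) * P.current t x p|
      ≤ 4 * ‖P.κ‖ * ε * ‖x‖ ^ 2 := by
  have hterm : ∀ p : ℕ × ℕ,
      |(cutoff ε p - cutoff ε (p.1 + 1, p.2 + 1)) * P.current t x p|
        ≤ 2 * ‖P.κ‖ * ε * (‖x p‖ ^ 2 + ‖x (p.1 + 1, p.2 + 1)‖ ^ 2) := by
    intro p
    have h1 : |P.current t x p|
        ≤ 2 * (‖P.κ‖ * (√(p.1 + 1) * √(p.2 + 1)) * (‖x p‖ * ‖x (p.1 + 1, p.2 + 1)‖)) := by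
      rw [current, abs_mul, abs_of_pos (by norm_num : (0 : ℝ) < 2)]
      refine mul_le_mul_of_nonneg_left ((Complex.abs_im_le_norm _).trans_eq ?_) (by norm_num)
      rw [norm_mul, norm_mul, norm_mul, RCLike.norm_conj, P.norm_coupling, Complex.norm_real,
        Real.norm_of_nonneg (by positivity)]
    have h2 := abs_cutoff_sub_mul_le hε p
    have h3 := two_mul_le_add_sq ‖x p‖ ‖x (p.1 + 1, p.2 + 1)‖
    rw [abs_mul]
    calc _ ≤ |cutoff ε p - cutoff ε (p.1 + 1, p.2 + 1)|
          * (2 * (‖P.κ‖ * (√(p.1 + 1) * √(p.2 + 1)) * (‖x p‖ * ‖x (p.1 + 1, p.2 + 1)‖))) := by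
          gcongr
      _ = (|cutoff ε p - cutoff ε (p.1 + 1, p.2 + 1)| * (√(p.1 + 1) * √(p.2 + 1)))
          * (‖P.κ‖ * (2 * ‖x p‖ * ‖x (p.1 + 1, p.2 + 1)‖)) := by ring
      _ ≤ (2 * ε) * (‖P.κ‖ * (‖x p‖ ^ 2 + ‖x (p.1 + 1, p.2 + 1)‖ ^ 2)) := by gcongr
      _ = _ := by ring
  refine (Finset.abs_sum_le_sum_abs _ _).trans ((Finset.sum_le_sum fun p _ => hterm p).trans ?_)
  rw [← Finset.mul_sum, Finset.sum_add_distrib]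
  have a1 := Fock.sum_norm_sq_comp_le x s Function.injective_id
  have a2 := Fock.sum_norm_sq_comp_le x s (e := fun p => (p.1 + 1, p.2 + 1)) (fun p q h => by
    simp only [Prod.mk.injEq, add_left_inj] at h
    exact Prod.ext h.1 h.2)
  simp only [id] at a1
  have : 0 ≤ 2 * ‖P.κ‖ * ε := by positivity
  nlinarith

/-- The cut-off norm of a bounded weak solution changes by an amount of order `ε`. -/
theorem Amplifier.IsWeakSolution.sum_cutoff_sub_le {P : Amplifier} {c : ℝ → Fock}
    (hc : P.IsWeakSolution c) {T M : ℝ} (hM : ∀ s : ℝ, |s| ≤ T → ‖c s‖ ≤ M) {ε : ℝ} (hε : 0 < ε)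
    {L : ℕ} (hL : Real.exp (1 / ε) ≤ L) {t₁ t₂ : ℝ} (h₁ : |t₁| ≤ T) (h₂ : |t₂| ≤ T) :
    ∑ p ∈ Finset.range L ×ˢ Finset.range L, cutoff ε p * ‖c t₂ p‖ ^ 2
      ≤ ∑ p ∈ Finset.range L ×ˢ Finset.range L, cutoff ε p * ‖c t₁ p‖ ^ 2
        + 4 * ‖P.κ‖ * ε * M ^ 2 * |t₂ - t₁| := by
  set Φ : ℝ → ℝ := fun t => ∑ p ∈ Finset.range L ×ˢ Finset.range L, cutoff ε p * ‖c t p‖ ^ 2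
  have hzero : ∀ p : ℕ × ℕ, L ≤ p.1 ∨ L ≤ p.2 → cutoff ε p = 0 := by
    intro p hp
    refine cutoff_eq_zero hε (hL.trans ?_)
    have : L ≤ 1 + p.1 + p.2 := by omega
    exact_mod_cast this
  have hderiv : ∀ t, HasDerivAt Φ (∑ p ∈ Finset.range L ×ˢ Finset.range L,
      (cutoff ε p - cutoff ε (p.1 + 1, p.2 + 1)) * P.current t (c t) p) t := by
    intro t
    rw [← P.sum_cutoff_mul_re_generator t (c t) (cutoff ε) hzero]
    refine HasDerivAt.fun_sum fun p _ => HasDerivAt.const_mul _ ?_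
    have := (hc p t).norm_sq
    simp only [Complex.inner] at this
    exact this.congr_deriv (by rw [mul_comm (P.generator t (c t) p)])
  have hb : ∀ t ∈ Set.Icc (-T) T, ‖∑ p ∈ Finset.range L ×ˢ Finset.range L,
      (cutoff ε p - cutoff ε (p.1 + 1, p.2 + 1)) * P.current t (c t) p‖
        ≤ 4 * ‖P.κ‖ * ε * M ^ 2 := by
    intro t ht
    refine (P.abs_sum_cutoff_current_le t (c t) hε.le _).trans ?_
    have := hM t (abs_le.mpr ht)
    gcongr
  have := (convex_Icc (-T) T).norm_image_sub_le_of_norm_hasDerivWithin_le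
    (fun t _ => (hderiv t).hasDerivWithinAt) hb (abs_le.mp h₁) (abs_le.mp h₂)
  have := (le_abs_self _).trans this
  rw [Real.norm_eq_abs] at this
  linarith

/-- Letting `ε → 0` in `sum_cutoff_sub_le` removes the cut-off. -/
theorem Amplifier.IsWeakSolution.norm_le {P : Amplifier} {c : ℝ → Fock}
    (hc : P.IsWeakSolution c) (hb : LocallyBounded c) (t₁ t₂ : ℝ) : ‖c t₂‖ ≤ ‖c t₁‖ := by
  obtain ⟨M, hM⟩ := hb (max |t₁| |t₂|)
  refine lp.norm_le_of_forall_sum_le (by simp) (norm_nonneg _) fun s => ?_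
  simp only [ENNReal.toReal_ofNat, Real.rpow_ofNat]
  have key : ∀ ε : ℝ, 0 < ε → ∑ p ∈ s, cutoff ε p * ‖c t₂ p‖ ^ 2
      ≤ ‖c t₁‖ ^ 2 + 4 * ‖P.κ‖ * ε * M ^ 2 * |t₂ - t₁| := by
    intro ε hε
    obtain ⟨L₁, hL₁⟩ := exists_nat_ge (Real.exp (1 / ε))
    obtain ⟨L₂, hL₂⟩ := s.bddAbove
    set L := max L₁ (max (L₂.1 + 1) (L₂.2 + 1))
    have hsub : s ⊆ Finset.range L ×ˢ Finset.range L := by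
      intro p hp
      have := hL₂ hp
      have h1 := this.1
      have h2 := this.2
      simp only [Finset.mem_product, Finset.mem_range, L, lt_max_iff]
      omega
    have hL : Real.exp (1 / ε) ≤ L := hL₁.trans (by exact_mod_cast le_max_left _ _)
    refine (Finset.sum_le_sum_of_subset_of_nonneg hsub fun p _ _ =>
      mul_nonneg (cutoff_nonneg ε p) (by positivity)).trans
      ((hc.sum_cutoff_sub_le hM hε hL (le_max_left _ _) (le_max_right _ _)).trans ?_)
    gcongr
    refine le_trans (Finset.sum_le_sum fun p _ => ?_)
      (Fock.sum_norm_sq_comp_le (c t₁) (Finset.range L ×ˢ Finset.range L) Function.injective_id)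
    exact mul_le_of_le_one_left (by positivity) (cutoff_le_one hε.le p)
  have hlim1 : Filter.Tendsto (fun ε : ℝ => ∑ p ∈ s, cutoff ε p * ‖c t₂ p‖ ^ 2)
      (nhdsWithin 0 (Set.Ioi 0)) (nhds (∑ p ∈ s, ‖c t₂ p‖ ^ 2)) := by
    have : Continuous (fun ε : ℝ => ∑ p ∈ s, cutoff ε p * ‖c t₂ p‖ ^ 2) := by
      unfold cutoff; fun_prop
    have h := (this.tendsto 0).mono_left (nhdsWithin_le_nhds (s := Set.Ioi 0))
    simpa [cutoff] using h
  have hlim2 : Filter.Tendsto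
      (fun ε : ℝ => ‖c t₁‖ ^ 2 + 4 * ‖P.κ‖ * ε * M ^ 2 * |t₂ - t₁|)
      (nhdsWithin 0 (Set.Ioi 0)) (nhds (‖c t₁‖ ^ 2)) := by
    have : Continuous
      (fun ε : ℝ => ‖c t₁‖ ^ 2 + 4 * ‖P.κ‖ * ε * M ^ 2 * |t₂ - t₁|) := by fun_prop
    have h := (this.tendsto 0).mono_left (nhdsWithin_le_nhds (s := Set.Ioi 0))
    simpa using h
  exact le_of_tendsto_of_tendsto hlim1 hlim2
    (Filter.eventually_of_mem self_mem_nhdsWithin fun ε hε => key ε hε)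

/-- A locally bounded weak solution has constant norm. -/
theorem Amplifier.IsWeakSolution.norm_eq {P : Amplifier} {c : ℝ → Fock}
    (hc : P.IsWeakSolution c) (hb : LocallyBounded c) (t₁ t₂ : ℝ) : ‖c t₂‖ = ‖c t₁‖ :=
  le_antisymm (hc.norm_le hb t₁ t₂) (hc.norm_le hb t₂ t₁)

/-- Locally bounded weak solutions that agree at one time agree at all times. -/
theorem Amplifier.IsWeakSolution.eq_of_eq {P : Amplifier} {c d : ℝ → Fock}
    (hc : P.IsWeakSolution c) (hcb : LocallyBounded c) (hd : P.IsWeakSolution d)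
    (hdb : LocallyBounded d) {t₀ : ℝ} (h : c t₀ = d t₀) (t : ℝ) : c t = d t := by
  have := (hc.add (hd.const_smul (-1))).norm_eq (hcb.add (hdb.const_smul (-1))) t₀ t
  simp only [neg_smul, one_smul, h, add_neg_cancel, norm_zero, norm_eq_zero] at this
  exact eq_of_sub_eq_zero (by rw [sub_eq_add_neg, this])

/-! ### Gaussian vectors -/

/-- The divided power `x ^ j / j!`, extended by `0` to negative `j`, so that the recursion and the
derivative below hold for every integer index. -/
noncomputable def dividedPow (j : ℤ) (x : ℂ) : ℂ :=
  if 0 ≤ j then x ^ j.toNat / (j.toNat.factorial : ℂ) else 0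

theorem dividedPow_of_neg {j : ℤ} (hj : j < 0) (x : ℂ) : dividedPow j x = 0 :=
  if_neg (not_le.mpr hj)

@[simp] theorem dividedPow_natCast (j : ℕ) (x : ℂ) :
    dividedPow j x = x ^ j / (j.factorial : ℂ) := by
  simp [dividedPow]

theorem mul_dividedPow (j : ℤ) (x : ℂ) : j * dividedPow j x = x * dividedPow (j - 1) x := by
  rcases lt_trichotomy j 0 with hj | rfl | hj
  · rw [dividedPow_of_neg hj, dividedPow_of_neg (by omega)]; simp
  · rw [dividedPow_of_neg (show (0 : ℤ) - 1 < 0 by norm_num)]; simp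
  · obtain ⟨n, rfl⟩ : ∃ n : ℕ, j = ((n + 1 : ℕ) : ℤ) := ⟨j.toNat - 1, by omega⟩
    have e : ((n + 1 : ℕ) : ℤ) - 1 = (n : ℤ) := by push_cast; ring
    rw [e, dividedPow_natCast, dividedPow_natCast, Nat.factorial_succ]
    have : (n.factorial : ℂ) ≠ 0 := by exact_mod_cast n.factorial_ne_zero
    have : (n : ℂ) + 1 ≠ 0 := by exact_mod_cast n.succ_ne_zero
    push_cast
    field_simp
    ring

theorem hasDerivAt_dividedPow (j : ℤ) (x : ℂ) :
    HasDerivAt (dividedPow j) (dividedPow (j - 1) x) x := by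
  rcases lt_trichotomy j 0 with hj | rfl | hj
  · have : dividedPow j = fun _ => 0 := funext fun y => dividedPow_of_neg hj y
    rw [dividedPow_of_neg (by omega), this]
    exact hasDerivAt_const _ _
  · have : dividedPow 0 = fun _ => 1 := funext fun y => by simp [dividedPow]
    rw [dividedPow_of_neg (by norm_num), this]
    exact hasDerivAt_const _ _
  · obtain ⟨n, rfl⟩ : ∃ n : ℕ, j = ((n + 1 : ℕ) : ℤ) := ⟨j.toNat - 1, by omega⟩
    have e : ((n + 1 : ℕ) : ℤ) - 1 = (n : ℤ) := by push_cast; ring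
    have h : dividedPow ((n + 1 : ℕ) : ℤ)
        = fun y => y ^ (n + 1) / ((n + 1).factorial : ℂ) :=
      funext fun y => dividedPow_natCast _ y
    rw [e, dividedPow_natCast, h]
    refine ((hasDerivAt_pow (n + 1) x).div_const _).congr_deriv ?_
    rw [Nat.factorial_succ]
    have : (n.factorial : ℂ) ≠ 0 := by exact_mod_cast n.factorial_ne_zero
    have : (n : ℂ) + 1 ≠ 0 := by exact_mod_cast n.succ_ne_zero
    push_cast
    field_simp

/-- The coefficient of `z ^ m * w ^ n` in `exp (A z w + B z + C w)`, for integers `m`, `n`. -/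
noncomputable def gaussCoeff (A B C : ℂ) (m n : ℤ) : ℂ :=
  ∑ k ∈ Finset.range (m.toNat + 1), dividedPow k A * dividedPow (m - k) B * dividedPow (n - k) C

theorem gaussCoeff_eq_sum (A B C : ℂ) {m : ℤ} (n : ℤ) {L : ℕ} (hL : m < L) :
    gaussCoeff A B C m n = ∑ k ∈ Finset.range L,
      dividedPow k A * dividedPow (m - k) B * dividedPow (n - k) C := by
  have hz : ∀ k : ℕ, m < k → dividedPow (m - k) B = 0 := fun k hk =>
    dividedPow_of_neg (by omega) B
  rw [gaussCoeff]
  rcases le_total L (m.toNat + 1) with h | h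
  · refine (Finset.sum_subset (Finset.range_mono h) fun k hk hk' => ?_).symm
    simp only [Finset.mem_range] at hk hk'
    rw [hz k (by omega)]; ring
  · refine Finset.sum_subset (Finset.range_mono h) fun k hk hk' => ?_
    simp only [Finset.mem_range] at hk hk'
    rw [hz k (by omega)]; ring

theorem sum_dividedPow_shift (A B C : ℂ) (m n : ℤ) :
    ∑ k ∈ Finset.range (m.toNat + 1),
        dividedPow (k - 1) A * dividedPow (m - k) B * dividedPow (n - k) C
      = gaussCoeff A B C (m - 1) (n - 1) := by
  rw [Finset.sum_range_succ', gaussCoeff_eq_sum A B C (m := m - 1) (n - 1) (L := m.toNat) (by omega)]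
  rw [dividedPow_of_neg (show ((0 : ℕ) : ℤ) - 1 < 0 by norm_num)]
  simp only [zero_mul, add_zero]
  refine Finset.sum_congr rfl fun k _ => ?_
  push_cast
  congr 2
  · congr 2; ring
  · congr 1; ring
  · ring

theorem mul_gaussCoeff_left (A B C : ℂ) (m n : ℤ) : m * gaussCoeff A B C m n
    = A * gaussCoeff A B C (m - 1) (n - 1) + B * gaussCoeff A B C (m - 1) n := by
  rw [← sum_dividedPow_shift,
    gaussCoeff_eq_sum A B C (m := m - 1) n (L := m.toNat + 1) (by push_cast; omega),
    gaussCoeff, Finset.mul_sum, Finset.mul_sum, Finset.mul_sum, ← Finset.sum_add_distrib]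
  refine Finset.sum_congr rfl fun k _ => ?_
  have h1 := mul_dividedPow k A
  have h2 := mul_dividedPow (m - k) B
  have e : m - (k : ℤ) - 1 = m - 1 - k := by ring
  rw [e] at h2
  push_cast at h1 h2
  linear_combination dividedPow (m - k) B * dividedPow (n - k) C * h1
    + dividedPow k A * dividedPow (n - k) C * h2

theorem mul_gaussCoeff_right (A B C : ℂ) (m n : ℤ) : n * gaussCoeff A B C m n
    = A * gaussCoeff A B C (m - 1) (n - 1) + C * gaussCoeff A B C m (n - 1) := by
  rw [← sum_dividedPow_shift, gaussCoeff, gaussCoeff, Finset.mul_sum, Finset.mul_sum,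
    Finset.mul_sum, ← Finset.sum_add_distrib]
  refine Finset.sum_congr rfl fun k _ => ?_
  have h1 := mul_dividedPow k A
  have h2 := mul_dividedPow (n - k) C
  have e : n - (k : ℤ) - 1 = n - 1 - k := by ring
  rw [e] at h2
  push_cast at h1 h2
  linear_combination dividedPow (m - k) B * dividedPow (n - k) C * h1
    + dividedPow k A * dividedPow (m - k) B * h2

/-- The coefficient form of `∂_z ∂_w e^f = (A + (A w + B) (A z + C)) e^f` for
`f = A z w + B z + C w`. -/
theorem mul_mul_gaussCoeff_succ (A B C : ℂ) (m n : ℤ) :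
    (m + 1) * (n + 1) * gaussCoeff A B C (m + 1) (n + 1)
      = (A + B * C) * gaussCoeff A B C m n + A * B * gaussCoeff A B C (m - 1) n
        + A * C * gaussCoeff A B C m (n - 1)
        + A ^ 2 * gaussCoeff A B C (m - 1) (n - 1) := by
  have h1 := mul_gaussCoeff_left A B C (m + 1) (n + 1)
  have h2 := mul_gaussCoeff_right A B C m (n + 1)
  have h3 := mul_gaussCoeff_right A B C m n
  simp only [add_sub_cancel_right] at h1 h2
  push_cast at h1 h2 h3
  linear_combination (n + 1) * h1 + B * h2 + A * h3

theorem hasDerivAt_gaussCoeff {A B C : ℝ → ℂ} {A' B' C' : ℂ} {t : ℝ} (hA : HasDerivAt A A' t)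
    (hB : HasDerivAt B B' t) (hC : HasDerivAt C C' t) (m n : ℤ) :
    HasDerivAt (fun s => gaussCoeff (A s) (B s) (C s) m n)
      (A' * gaussCoeff (A t) (B t) (C t) (m - 1) (n - 1)
        + B' * gaussCoeff (A t) (B t) (C t) (m - 1) n
        + C' * gaussCoeff (A t) (B t) (C t) m (n - 1)) t := by
  rw [← sum_dividedPow_shift,
    gaussCoeff_eq_sum _ _ _ (m := m - 1) n (L := m.toNat + 1) (by push_cast; omega)]
  unfold gaussCoeff
  rw [Finset.mul_sum, Finset.mul_sum, Finset.mul_sum, ← Finset.sum_add_distrib,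
    ← Finset.sum_add_distrib]
  refine HasDerivAt.fun_sum fun k _ => ?_
  have e1 : m - (k : ℤ) - 1 = m - 1 - k := by ring
  have e2 : n - (k : ℤ) - 1 = n - 1 - k := by ring
  have h1 := (hasDerivAt_dividedPow k (A t)).comp t hA
  have h2 := (hasDerivAt_dividedPow (m - k) (B t)).comp t hB
  have h3 := (hasDerivAt_dividedPow (n - k) (C t)).comp t hC
  rw [e1] at h2
  rw [e2] at h3
  refine ((h1.mul h2).mul h3).congr_deriv ?_
  simp only [Function.comp, Pi.mul_apply]
  ring

/-- The term of the triple expansion of `exp (A z w + B z + C w)` with `A ^ k`, `B ^ i`, `C ^ j`,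
with the normalization of the number basis in Bargmann's representation. -/
noncomputable def gaussTerm (A B C : ℂ) (q : ℕ × ℕ × ℕ) : ℂ :=
  A ^ q.1 / (q.1.factorial : ℂ) * (B ^ q.2.1 / (q.2.1.factorial : ℂ)
    * (C ^ q.2.2 / (q.2.2.factorial : ℂ)))
    * ((√((q.2.1 + q.1).factorial : ℝ) * √((q.2.2 + q.1).factorial : ℝ) : ℝ) : ℂ)

/-- The Gaussian vector `exp (A a†b† + B a† + C b†) |0, 0⟩`, which lies in Fock space for
`‖A‖ < 1`. It is given by the triple expansion, which converges absolutely. -/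
noncomputable def gaussVec (A B C : ℂ) : Fock :=
  ∑' q : ℕ × ℕ × ℕ, gaussTerm A B C q • (lp.single 2 (q.2.1 + q.1, q.2.2 + q.1) (1 : ℂ) : Fock)

/-- The binomial bound `(i + k).choose i * s ^ i ≤ (1 + s) ^ (i + k)`, cleared of denominators. -/
theorem factorial_add_mul_pow_le {s : ℝ} (hs : 0 ≤ s) (i k : ℕ) :
    ((i + k).factorial : ℝ) * s ^ i ≤ k.factorial * i.factorial * (1 + s) ^ (i + k) := by
  have h1 : ((i + k).choose i : ℝ) * s ^ i ≤ (1 + s) ^ (i + k) := by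
    rw [add_comm 1 s, add_pow]
    have := Finset.single_le_sum (f := fun m => s ^ m * 1 ^ (i + k - m) * ((i + k).choose m : ℝ))
      (fun m _ => by positivity) (Finset.mem_range.mpr (show i < i + k + 1 by omega))
    simp only [one_pow, mul_one] at this ⊢
    linarith
  have h2 : ((i + k).factorial : ℝ) = (i + k).choose i * i.factorial * k.factorial := by
    rw [Nat.choose_symm_add]
    exact_mod_cast (Nat.add_choose_mul_factorial_mul_factorial i k).symm
  rw [h2]
  have : (0 : ℝ) ≤ k.factorial * i.factorial := by positivity
  nlinarith

/-- The growth rate in `k` can be taken arbitrarily close to `1`, at the price of a large factor per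
unit of `i`. This is what makes the Gaussian vectors converge for every `‖A‖ < 1`. -/
theorem sqrt_factorial_add_le {s : ℝ} (hs : 0 < s) (i k : ℕ) :
    √((i + k).factorial : ℝ)
      ≤ √(k.factorial : ℝ) * √(i.factorial : ℝ) * (√(1 + s) ^ k * √((1 + s) / s) ^ i) := by
  have h := factorial_add_mul_pow_le hs.le i k
  rw [Real.sqrt_le_left (by positivity)]
  have e : (√(k.factorial : ℝ) * √(i.factorial : ℝ) * (√(1 + s) ^ k * √((1 + s) / s) ^ i)) ^ 2
      = k.factorial * i.factorial * ((1 + s) ^ k * ((1 + s) / s) ^ i) := by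
    have e1 : (√(1 + s) ^ k) ^ 2 = (1 + s) ^ k := by
      rw [← pow_mul, mul_comm, pow_mul, Real.sq_sqrt (by positivity)]
    have e2 : (√((1 + s) / s) ^ i) ^ 2 = ((1 + s) / s) ^ i := by
      rw [← pow_mul, mul_comm, pow_mul, Real.sq_sqrt (by positivity)]
    rw [mul_pow, mul_pow, mul_pow, e1, e2, Real.sq_sqrt (by positivity),
      Real.sq_sqrt (by positivity)]
  rw [e, div_pow, ← mul_div_assoc, ← mul_div_assoc, le_div_iff₀ (by positivity), ← pow_add,
    add_comm k i]
  exact h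

/-- A summable majorant of `gaussTerm`, uniform for `‖A‖ ≤ a < 1`, `‖B‖ ≤ b` and `‖C‖ ≤ c`.
It comes from `sqrt_factorial_add_le` with `s = (1 - a) / 2`, for which `a * (1 + s) < 1`. -/
noncomputable def gaussMajorant (a b c : ℝ) (q : ℕ × ℕ × ℕ) : ℝ :=
  (a * (1 + (1 - a) / 2)) ^ q.1
    * ((b * √((1 + (1 - a) / 2) / ((1 - a) / 2))) ^ q.2.1 / √(q.2.1.factorial : ℝ)
      * ((c * √((1 + (1 - a) / 2) / ((1 - a) / 2))) ^ q.2.2 / √(q.2.2.factorial : ℝ)))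

/-- By the inequality of arithmetic and geometric means the terms are dominated by those of an
exponential series plus those of a geometric series. -/
theorem summable_pow_div_sqrt_factorial {x : ℝ} (hx : 0 ≤ x) :
    Summable fun i : ℕ => x ^ i / √(i.factorial : ℝ) := by
  have h1 := Real.summable_pow_div_factorial (4 * x ^ 2)
  have h2 := summable_geometric_of_lt_one (r := 1 / 4) (by norm_num) (by norm_num)
  refine Summable.of_nonneg_of_le (fun i => by positivity) (fun i => ?_) (h1.add h2)
  have e1 : (x ^ i * 2 ^ i / √(i.factorial : ℝ)) ^ 2 = (4 * x ^ 2) ^ i / i.factorial := by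
    rw [div_pow, Real.sq_sqrt (by positivity), ← mul_pow, ← pow_mul, mul_comm i 2, pow_mul]
    congr 2; ring
  have e2 : ((1 / 2 : ℝ) ^ i) ^ 2 = (1 / 4) ^ i := by
    rw [← pow_mul, mul_comm i 2, pow_mul]; norm_num
  have e3 : x ^ i / √(i.factorial : ℝ)
      = (x ^ i * 2 ^ i / √(i.factorial : ℝ)) * (1 / 2 : ℝ) ^ i := by
    rw [one_div, inv_pow]; field_simp
  have := two_mul_le_add_sq (x ^ i * 2 ^ i / √(i.factorial : ℝ)) ((1 / 2 : ℝ) ^ i)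
  rw [e1, e2] at this
  have h0 : 0 ≤ x ^ i / √(i.factorial : ℝ) := by positivity
  rw [mul_assoc, ← e3] at this
  linarith

theorem summable_gaussMajorant {a b c : ℝ} (ha : 0 ≤ a) (ha1 : a < 1) (hb : 0 ≤ b)
    (hc : 0 ≤ c) : Summable (gaussMajorant a b c) := by
  have h1 := summable_geometric_of_lt_one (r := a * (1 + (1 - a) / 2))
    (by have := sub_pos.mpr ha1; positivity) (by nlinarith)
  have h2 := summable_pow_div_sqrt_factorial
    (x := b * √((1 + (1 - a) / 2) / ((1 - a) / 2))) (by positivity)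
  have h3 := summable_pow_div_sqrt_factorial
    (x := c * √((1 + (1 - a) / 2) / ((1 - a) / 2))) (by positivity)
  have h4 := h2.mul_of_nonneg h3 (fun i => by positivity) (fun i => by positivity)
  exact h1.mul_of_nonneg h4 (fun i => by have := sub_pos.mpr ha1; positivity)
    (fun i => by positivity)

theorem norm_gaussTerm_le {A B C : ℂ} {a b c : ℝ} (hA : ‖A‖ ≤ a) (ha1 : a < 1) (hB : ‖B‖ ≤ b)
    (hC : ‖C‖ ≤ c) (q : ℕ × ℕ × ℕ) : ‖gaussTerm A B C q‖ ≤ gaussMajorant a b c q := by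
  obtain ⟨k, i, j⟩ := q
  have hs : 0 < (1 - a) / 2 := by linarith
  have ha : 0 ≤ a := (norm_nonneg _).trans hA
  have hb : 0 ≤ b := (norm_nonneg _).trans hB
  have hc : 0 ≤ c := (norm_nonneg _).trans hC
  simp only [gaussTerm, gaussMajorant]
  set s := (1 - a) / 2
  have h1 := sqrt_factorial_add_le hs i k
  have h2 := sqrt_factorial_add_le hs j k
  set D := √((1 + s) / s)
  have hw : √(1 + s) ^ k * √(1 + s) ^ k = (1 + s) ^ k := by
    rw [← mul_pow, Real.mul_self_sqrt (by positivity)]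
  have hk : √(k.factorial : ℝ) * √(k.factorial : ℝ) = k.factorial :=
    Real.mul_self_sqrt (by positivity)
  have hi : √(i.factorial : ℝ) * √(i.factorial : ℝ) = i.factorial :=
    Real.mul_self_sqrt (by positivity)
  have hj : √(j.factorial : ℝ) * √(j.factorial : ℝ) = j.factorial :=
    Real.mul_self_sqrt (by positivity)
  simp only [norm_mul, norm_div, norm_pow, Complex.norm_real, Complex.norm_natCast,
    Real.norm_of_nonneg (Real.sqrt_nonneg _)]
  calc _ ≤ a ^ k / k.factorial * (b ^ i / i.factorial * (c ^ j / j.factorial))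
        * ((√(k.factorial : ℝ) * √(i.factorial : ℝ) * (√(1 + s) ^ k * D ^ i))
          * (√(k.factorial : ℝ) * √(j.factorial : ℝ) * (√(1 + s) ^ k * D ^ j))) := by
        gcongr
    _ = a ^ k * (√(1 + s) ^ k * √(1 + s) ^ k) * ((√(k.factorial : ℝ) * √(k.factorial : ℝ))
          / k.factorial) * ((b ^ i * D ^ i) * (√(i.factorial : ℝ) / i.factorial)
          * ((c ^ j * D ^ j) * (√(j.factorial : ℝ) / j.factorial))) := by ring
    _ = _ := by
      rw [hw, hk, Real.sqrt_div_self, Real.sqrt_div_self, div_self (by positivity), mul_pow,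
        mul_pow, mul_pow]
      ring

theorem norm_single_one (p : ℕ × ℕ) : ‖(lp.single 2 p (1 : ℂ) : Fock)‖ = 1 := by
  rw [lp.norm_single (by simp)]; simp

theorem hasSum_gaussVec {A : ℂ} (hA : ‖A‖ < 1) (B C : ℂ) :
    HasSum (fun q : ℕ × ℕ × ℕ =>
      gaussTerm A B C q • (lp.single 2 (q.2.1 + q.1, q.2.2 + q.1) (1 : ℂ) : Fock))
      (gaussVec A B C) := by
  refine Summable.hasSum (Summable.of_norm_bounded
    (summable_gaussMajorant (norm_nonneg A) hA (norm_nonneg B) (norm_nonneg C)) fun q => ?_)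
  rw [norm_smul, norm_single_one, mul_one]
  exact norm_gaussTerm_le le_rfl hA le_rfl le_rfl q

theorem norm_gaussVec_le {A B C : ℂ} {a b c : ℝ} (hA : ‖A‖ ≤ a) (ha1 : a < 1) (hB : ‖B‖ ≤ b)
    (hC : ‖C‖ ≤ c) : ‖gaussVec A B C‖ ≤ ∑' q, gaussMajorant a b c q := by
  refine tsum_of_norm_bounded (summable_gaussMajorant ((norm_nonneg _).trans hA) ha1
    ((norm_nonneg _).trans hB) ((norm_nonneg _).trans hC)).hasSum fun q => ?_
  rw [norm_smul, norm_single_one, mul_one]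
  exact norm_gaussTerm_le hA ha1 hB hC q

theorem gaussVec_apply {A : ℂ} (hA : ‖A‖ < 1) (B C : ℂ) (p : ℕ × ℕ) :
    gaussVec A B C p = ((√(p.1.factorial : ℝ) * √(p.2.factorial : ℝ) : ℝ) : ℂ)
      * gaussCoeff A B C p.1 p.2 := by
  obtain ⟨m, n⟩ := p
  have h := (hasSum_gaussVec hA B C).mapL (lp.evalCLM ℂ (fun _ : ℕ × ℕ => ℂ) 2 (m, n))
  refine h.unique ?_
  have hinj : Function.Injective (fun k : ℕ => ((k, m - k, n - k) : ℕ × ℕ × ℕ)) :=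
    fun k l hkl => (Prod.mk.inj hkl).1
  have hsum := hasSum_sum_of_ne_finset_zero (f := fun q : ℕ × ℕ × ℕ =>
      lp.evalCLM ℂ (fun _ : ℕ × ℕ => ℂ) 2 (m, n)
        (gaussTerm A B C q • (lp.single 2 (q.2.1 + q.1, q.2.2 + q.1) (1 : ℂ) : Fock)))
      (s := (Finset.range (m + 1)).image (fun k : ℕ => ((k, m - k, n - k) : ℕ × ℕ × ℕ)))
      (L := SummationFilter.unconditional _) (fun q hq => by
    have hne : (m, n) ≠ (q.2.1 + q.1, q.2.2 + q.1) := by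
      rintro h
      simp only [Prod.mk.injEq] at h
      refine hq (Finset.mem_image.mpr ⟨q.1, Finset.mem_range.mpr (by omega), ?_⟩)
      exact Prod.ext rfl (Prod.ext (by simp only; omega) (by simp only; omega))
    rw [map_smul]
    change gaussTerm A B C q • (lp.single 2 (q.2.1 + q.1, q.2.2 + q.1) (1 : ℂ) : Fock) (m, n) = 0
    rw [lp.single_apply_ne _ _ _ hne, smul_zero])
  -- only the terms `(k, m - k, n - k)` contribute; for `k > n` both sides vanish
  refine Eq.subst (motive := fun z => HasSum _ z _) ?_ hsum
  rw [Finset.sum_image fun a _ b _ h => hinj h, gaussCoeff, Int.toNat_natCast, Finset.mul_sum]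
  refine Finset.sum_congr rfl fun k hk => ?_
  have hkm : k ≤ m := Nat.lt_succ_iff.mp (Finset.mem_range.mp hk)
  rw [map_smul]
  change gaussTerm A B C (k, m - k, n - k)
    • (lp.single 2 (m - k + k, n - k + k) (1 : ℂ) : Fock) (m, n) = _
  rw [Nat.sub_add_cancel hkm]
  rcases le_or_gt k n with hkn | hkn
  · rw [Nat.sub_add_cancel hkn, lp.single_apply_self, gaussTerm]
    simp only [Nat.sub_add_cancel hkm, Nat.sub_add_cancel hkn]
    rw [← Nat.cast_sub hkm, ← Nat.cast_sub hkn]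
    simp only [dividedPow_natCast, smul_eq_mul]
    ring
  · rw [lp.single_apply_ne _ _ _ (fun h => by simp only [Prod.mk.injEq] at h; omega),
      dividedPow_of_neg (show (n : ℤ) - k < 0 by omega)]
    simp

theorem hasSum_mul_complex {ι ι' : Type*} {f : ι → ℂ} {g : ι' → ℂ} {a b : ℂ} (hf : HasSum f a)
    (hg : HasSum g b) : HasSum (fun x : ι × ι' => f x.1 * g x.2) (a * b) := by
  have h : Summable (fun x : ι × ι' => f x.1 * g x.2) :=
    summable_mul_of_summable_norm hf.summable.norm hg.summable.norm
  exact hf.mul hg h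

theorem hasSum_const_mul_complex {ι : Type*} {f : ι → ℂ} {a : ℂ} (c : ℂ) (hf : HasSum f a) :
    HasSum (fun x => c * f x) (c * a) :=
  hf.mul_left c

theorem hasSum_pow_div_factorial (x : ℂ) :
    HasSum (fun n : ℕ => x ^ n / (n.factorial : ℂ)) (Complex.exp x) := by
  rw [Complex.exp_eq_exp_ℂ]
  exact NormedSpace.expSeries_div_hasSum_exp x

/-- The Bargmann function of a Gaussian vector. -/
theorem inner_coherent_gaussVec {A : ℂ} (hA : ‖A‖ < 1) (B C α β : ℂ) :
    inner ℂ (coherent α β) (gaussVec A B C)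
      = Complex.exp (-(((‖α‖ ^ 2 + ‖β‖ ^ 2) / 2 : ℝ) : ℂ)
          + A * (starRingEnd ℂ α * starRingEnd ℂ β) + B * starRingEnd ℂ α
          + C * starRingEnd ℂ β) := by
  have h : HasSum (fun q : ℕ × ℕ × ℕ => gaussTerm A B C q * starRingEnd ℂ
      (coherentCoeff α β (q.2.1 + q.1, q.2.2 + q.1)))
      (inner ℂ (coherent α β) (gaussVec A B C)) := by
    have h' := (hasSum_gaussVec hA B C).mapL (innerSL ℂ (coherent α β))
    rw [innerSL_apply_apply] at h'
    refine h'.congr_fun fun q => ?_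
    rw [innerSL_apply_apply, inner_smul_right, lp.inner_single_right]
    simp [coherent]
  have h1 := hasSum_pow_div_factorial (A * (starRingEnd ℂ α * starRingEnd ℂ β))
  have h2 := hasSum_pow_div_factorial (B * starRingEnd ℂ α)
  have h3 := hasSum_pow_div_factorial (C * starRingEnd ℂ β)
  have h123 : HasSum _ _ := hasSum_const_mul_complex
    (Complex.exp (-(((‖α‖ ^ 2 + ‖β‖ ^ 2) / 2 : ℝ) : ℂ)))
    (hasSum_mul_complex h1 (hasSum_mul_complex h2 h3))
  have e : Complex.exp (-(((‖α‖ ^ 2 + ‖β‖ ^ 2) / 2 : ℝ) : ℂ))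
        * (Complex.exp (A * (starRingEnd ℂ α * starRingEnd ℂ β))
          * (Complex.exp (B * starRingEnd ℂ α) * Complex.exp (C * starRingEnd ℂ β)))
      = Complex.exp (-(((‖α‖ ^ 2 + ‖β‖ ^ 2) / 2 : ℝ) : ℂ)
          + A * (starRingEnd ℂ α * starRingEnd ℂ β) + B * starRingEnd ℂ α
          + C * starRingEnd ℂ β) := by
    rw [Complex.exp_add, Complex.exp_add, Complex.exp_add]; ring
  rw [e] at h123
  refine h.unique ?_
  refine h123.congr_fun fun q => ?_
  obtain ⟨k, i, j⟩ := q
  have f1 : ((√((i + k).factorial : ℝ) : ℝ) : ℂ) ≠ 0 := by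
    exact_mod_cast (Real.sqrt_pos.mpr (by positivity)).ne'
  have f2 : ((√((j + k).factorial : ℝ) : ℝ) : ℂ) ≠ 0 := by
    exact_mod_cast (Real.sqrt_pos.mpr (by positivity)).ne'
  have e4 : Complex.exp (-(((‖α‖ ^ 2 + ‖β‖ ^ 2) / 2 : ℝ) : ℂ))
      = ((Real.exp (-‖α‖ ^ 2 / 2) : ℝ) : ℂ) * ((Real.exp (-‖β‖ ^ 2 / 2) : ℝ) : ℂ) := by
    rw [← Complex.ofReal_mul, ← Real.exp_add, Complex.ofReal_exp]
    congr 1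
    push_cast
    ring
  rw [e4]
  simp only [gaussTerm, coherentCoeff, map_mul, map_div₀, map_pow, Complex.conj_ofReal,
    Complex.ofReal_mul, mul_pow, pow_add]
  generalize ((√((i + k).factorial : ℝ) : ℝ) : ℂ) = u at f1 ⊢
  generalize ((√((j + k).factorial : ℝ) : ℝ) : ℂ) = v at f2 ⊢
  have key : ∀ X : ℂ, X = (u * u⁻¹) * (v * v⁻¹) * X := fun X => by
    rw [mul_inv_cancel₀ f1, mul_inv_cancel₀ f2]; ring
  refine Eq.trans ?_ (key _).symm
  ring

theorem coherent_eq_smul_gaussVec (α β : ℂ) :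
    coherent α β = Complex.exp (-(((‖α‖ ^ 2 + ‖β‖ ^ 2) / 2 : ℝ) : ℂ)) • gaussVec 0 α β := by
  ext p
  obtain ⟨m, n⟩ := p
  rw [lp.coeFn_smul, Pi.smul_apply, gaussVec_apply (by simp), gaussCoeff,
    Finset.sum_eq_single 0]
  · change coherentCoeff α β (m, n) = _
    simp only [coherentCoeff]
    have e4 : Complex.exp (-(((‖α‖ ^ 2 + ‖β‖ ^ 2) / 2 : ℝ) : ℂ))
        = ((Real.exp (-‖α‖ ^ 2 / 2) : ℝ) : ℂ) * ((Real.exp (-‖β‖ ^ 2 / 2) : ℝ) : ℂ) := by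
      rw [← Complex.ofReal_mul, ← Real.exp_add, Complex.ofReal_exp]
      congr 1
      push_cast
      ring
    have f1 : ((√(m.factorial : ℝ) : ℝ) : ℂ) * ((√(m.factorial : ℝ) : ℝ) : ℂ)
        = (m.factorial : ℂ) := by
      rw [← Complex.ofReal_mul, Real.mul_self_sqrt (by positivity)]; simp
    have f2 : ((√(n.factorial : ℝ) : ℝ) : ℂ) * ((√(n.factorial : ℝ) : ℝ) : ℂ)
        = (n.factorial : ℂ) := by
      rw [← Complex.ofReal_mul, Real.mul_self_sqrt (by positivity)]; simp
    have g1 : ((√(m.factorial : ℝ) : ℝ) : ℂ) ≠ 0 := by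
      exact_mod_cast (Real.sqrt_pos.mpr (by positivity)).ne'
    have g2 : ((√(n.factorial : ℝ) : ℝ) : ℂ) ≠ 0 := by
      exact_mod_cast (Real.sqrt_pos.mpr (by positivity)).ne'
    rw [e4]
    simp only [Nat.cast_zero, sub_zero, dividedPow_natCast, ← f1, ← f2]
    simp only [dividedPow, le_refl, if_true, Int.toNat_zero, pow_zero, Nat.factorial_zero,
      Nat.cast_one, div_one, Complex.ofReal_mul, smul_eq_mul]
    field_simp
  · intro k _ hk
    rw [dividedPow_natCast, zero_pow hk]; simp
  · simp

/-! ### The hyperbolic functions of the amplifier -/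

/-- The real number `sinh (φ t) / φ`. -/
noncomputable def Amplifier.sh (P : Amplifier) (t : ℝ) : ℝ := (P.sinhRatio t).re

/-- The real number `cosh (φ t)`. -/
noncomputable def Amplifier.ch (P : Amplifier) (t : ℝ) : ℝ := (Complex.cosh (P.φ * t)).re

theorem Amplifier.φ_sq (P : Amplifier) :
    P.φ ^ 2 = ((‖P.κ‖ ^ 2 - (P.δ / 2) ^ 2 : ℝ) : ℂ) := by
  have h := Complex.cpow_nat_inv_pow ((‖P.κ‖ ^ 2 - (P.δ / 2) ^ 2 : ℝ) : ℂ) (n := 2) two_ne_zero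
  rw [Amplifier.φ, one_div]
  exact_mod_cast h

/-- `φ` is real or purely imaginary. -/
theorem Amplifier.conj_φ (P : Amplifier) :
    starRingEnd ℂ P.φ = P.φ ∨ starRingEnd ℂ P.φ = -P.φ := by
  rw [← sq_eq_sq_iff_eq_or_eq_neg, ← map_pow, P.φ_sq, Complex.conj_ofReal]

theorem Amplifier.ofReal_sh (P : Amplifier) (t : ℝ) : (P.sh t : ℂ) = P.sinhRatio t := by
  refine Complex.conj_eq_iff_re.mp ?_
  unfold sinhRatio
  split_ifs with h
  · simp
  · rw [map_div₀, ← Complex.sinh_conj, map_mul, Complex.conj_ofReal]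
    rcases P.conj_φ with e | e
    · rw [e]
    · rw [e, neg_mul, Complex.sinh_neg, neg_div_neg_eq]

theorem Amplifier.ofReal_ch (P : Amplifier) (t : ℝ) :
    (P.ch t : ℂ) = Complex.cosh (P.φ * t) := by
  refine Complex.conj_eq_iff_re.mp ?_
  rw [← Complex.cosh_conj, map_mul, Complex.conj_ofReal]
  rcases P.conj_φ with e | e
  · rw [e]
  · rw [e, neg_mul, Complex.cosh_neg]

theorem Amplifier.φ_mul_sinhRatio (P : Amplifier) (t : ℝ) :
    P.φ * P.sinhRatio t = Complex.sinh (P.φ * t) := by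
  unfold sinhRatio
  split_ifs with h
  · simp [h]
  · field_simp

theorem hasDerivAt_const_mul_ofReal (c : ℂ) (t : ℝ) :
    HasDerivAt (fun s : ℝ => c * (s : ℂ)) c t := by
  simpa using (Complex.ofRealCLM.hasDerivAt (x := t)).const_mul c

theorem Amplifier.hasDerivAt_sinhRatio (P : Amplifier) (t : ℝ) :
    HasDerivAt P.sinhRatio (Complex.cosh (P.φ * t)) t := by
  by_cases h : P.φ = 0
  · have e : P.sinhRatio = fun s : ℝ => 1 * (s : ℂ) := funext fun s => by simp [sinhRatio, h]
    rw [e, h, zero_mul, Complex.cosh_zero]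
    exact hasDerivAt_const_mul_ofReal 1 t
  · have e : P.sinhRatio = fun s : ℝ => Complex.sinh (P.φ * s) / P.φ :=
      funext fun s => by simp [sinhRatio, h]
    rw [e]
    refine ((((Complex.hasDerivAt_sinh _).comp t
      (hasDerivAt_const_mul_ofReal P.φ t))).div_const P.φ).congr_deriv ?_
    field_simp

theorem Amplifier.hasDerivAt_cosh (P : Amplifier) (t : ℝ) :
    HasDerivAt (fun s : ℝ => Complex.cosh (P.φ * s))
      (((‖P.κ‖ ^ 2 - (P.δ / 2) ^ 2 : ℝ) : ℂ) * P.sinhRatio t) t := by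
  refine ((Complex.hasDerivAt_cosh _).comp t (hasDerivAt_const_mul_ofReal P.φ t)).congr_deriv ?_
  rw [← P.φ_sq, ← P.φ_mul_sinhRatio]
  ring

theorem Amplifier.hasDerivAt_sh (P : Amplifier) (t : ℝ) :
    HasDerivAt (fun s : ℝ => (P.sh s : ℂ)) (P.ch t) t := by
  simpa only [P.ofReal_sh, P.ofReal_ch] using P.hasDerivAt_sinhRatio t

theorem Amplifier.hasDerivAt_ch (P : Amplifier) (t : ℝ) :
    HasDerivAt (fun s : ℝ => (P.ch s : ℂ))
      (((‖P.κ‖ ^ 2 - (P.δ / 2) ^ 2 : ℝ) : ℂ) * P.sh t) t := by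
  simpa only [P.ofReal_sh, P.ofReal_ch] using P.hasDerivAt_cosh t

theorem Amplifier.ch_sq (P : Amplifier) (t : ℝ) :
    P.ch t ^ 2 = 1 + (‖P.κ‖ ^ 2 - (P.δ / 2) ^ 2) * P.sh t ^ 2 := by
  have h := Complex.cosh_sq_sub_sinh_sq (P.φ * t)
  rw [← P.φ_mul_sinhRatio, mul_pow, P.φ_sq, ← P.ofReal_sh, ← P.ofReal_ch] at h
  have : P.ch t ^ 2 - (‖P.κ‖ ^ 2 - (P.δ / 2) ^ 2) * P.sh t ^ 2 = 1 := by exact_mod_cast h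
  linarith

@[simp] theorem Amplifier.sh_zero (P : Amplifier) : P.sh 0 = 0 := by
  simp [sh, sinhRatio]

@[simp] theorem Amplifier.ch_zero (P : Amplifier) : P.ch 0 = 1 := by
  simp [ch]

/-- The Bogoliubov coefficient `cosh (φ t) - i (δ / 2) sinh (φ t) / φ`. -/
noncomputable def Amplifier.bog (P : Amplifier) (t : ℝ) : ℂ :=
  P.ch t - Complex.I * (P.δ / 2) * P.sh t

@[simp] theorem Amplifier.bog_zero (P : Amplifier) : P.bog 0 = 1 := by
  simp [bog]

theorem Amplifier.normSq_bog (P : Amplifier) (t : ℝ) :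
    Complex.normSq (P.bog t) = 1 + ‖P.κ‖ ^ 2 * P.sh t ^ 2 := by
  have e : P.bog t = ⟨P.ch t, -(P.δ / 2 * P.sh t)⟩ := by
    apply Complex.ext <;> simp [bog]
  rw [e, Complex.normSq_mk]
  linear_combination P.ch_sq t

theorem Amplifier.bog_ne_zero (P : Amplifier) (t : ℝ) : P.bog t ≠ 0 := by
  have h : 0 < Complex.normSq (P.bog t) := by rw [P.normSq_bog]; positivity
  exact Complex.normSq_pos.mp h

theorem Amplifier.hasDerivAt_bog (P : Amplifier) (t : ℝ) :
    HasDerivAt P.bog (((‖P.κ‖ ^ 2 - (P.δ / 2) ^ 2 : ℝ) : ℂ) * P.sh t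
      - Complex.I * (P.δ / 2) * P.ch t) t :=
  (P.hasDerivAt_ch t).sub ((P.hasDerivAt_sh t).const_mul _)

theorem conj_mul_self_eq (z : ℂ) : starRingEnd ℂ z * z = ((‖z‖ ^ 2 : ℝ) : ℂ) := by
  rw [← Complex.normSq_eq_conj_mul_self, Complex.normSq_eq_norm_sq]

/-! ### Evolution of coherent states -/

/-- The parameter `A(t)` of the evolved coherent state `N exp (A a†b† + B a† + C b†) |0, 0⟩`. -/
noncomputable def Amplifier.solA (P : Amplifier) (t : ℝ) : ℂ :=
  -Complex.I * starRingEnd ℂ P.κ * P.sh t * Complex.exp (-(Complex.I * P.η) * t) / P.bog t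

/-- The parameter `B(t)` (for `ω = ωa`) or `C(t)` (for `ω = ωb`) of the evolved coherent state
`N exp (A a†b† + B a† + C b†) |0, 0⟩`. -/
noncomputable def Amplifier.solB (P : Amplifier) (ω : ℝ) (ζ : ℂ) (t : ℝ) : ℂ :=
  ζ * Complex.exp (-(Complex.I * (ω + P.δ / 2)) * t) / P.bog t

/-- The prefactor `N(t)` of the evolved coherent state
`N exp (A a†b† + B a† + C b†) |0, 0⟩`. -/
noncomputable def Amplifier.solN (P : Amplifier) (ζ ξ : ℂ) (t : ℝ) : ℂ :=
  Complex.exp (-(((‖ζ‖ ^ 2 + ‖ξ‖ ^ 2) / 2 : ℝ) : ℂ))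
    * (Complex.exp (-(Complex.I * (P.δ / 2)) * t) / P.bog t
      * Complex.exp (-(Complex.I * P.κ * ζ * ξ) * (P.sh t / P.bog t)))

theorem hasDerivAt_cexp_mul (c : ℂ) (t : ℝ) :
    HasDerivAt (fun s : ℝ => Complex.exp (c * s)) (c * Complex.exp (c * t)) t := by
  refine ((Complex.hasDerivAt_exp _).comp t (hasDerivAt_const_mul_ofReal c t)).congr_deriv ?_
  ring

/-- The Wronskian of `sinh (φ t) / φ` and the Bogoliubov coefficient. -/
theorem Amplifier.wronskian (P : Amplifier) (t : ℝ) :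
    P.ch t * P.bog t - P.sh t * (((‖P.κ‖ ^ 2 - (P.δ / 2) ^ 2 : ℝ) : ℂ) * P.sh t
      - Complex.I * (P.δ / 2) * P.ch t) = 1 := by
  have h : ((P.ch t ^ 2 : ℝ) : ℂ)
      = ((1 + (‖P.κ‖ ^ 2 - (P.δ / 2) ^ 2) * P.sh t ^ 2 : ℝ) : ℂ) := by rw [P.ch_sq]
  push_cast at h ⊢
  rw [bog]
  linear_combination h

theorem Amplifier.exp_mul_exp_neg (P : Amplifier) (t : ℝ) :
    Complex.exp (Complex.I * P.η * t) * Complex.exp (-(Complex.I * P.η) * t) = 1 := by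
  rw [← Complex.exp_add]
  simp

/-- The Riccati equation for `A(t)`. -/
theorem Amplifier.hasDerivAt_solA (P : Amplifier) (t : ℝ) :
    HasDerivAt P.solA (-Complex.I * ((P.ωa + P.ωb) * P.solA t + P.coupling t * P.solA t ^ 2
      + starRingEnd ℂ (P.coupling t))) t := by
  have hx := P.bog_ne_zero t
  have hE := P.exp_mul_exp_neg t
  have hk := conj_mul_self_eq P.κ
  have h1 := P.wronskian t
  have h2 : P.bog t ^ 2 + Complex.I * P.δ * P.sh t * P.bog t
      - starRingEnd ℂ P.κ * P.κ * P.sh t ^ 2 = 1 := by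
    rw [hk]
    have h : ((P.ch t ^ 2 : ℝ) : ℂ)
      = ((1 + (‖P.κ‖ ^ 2 - (P.δ / 2) ^ 2) * P.sh t ^ 2 : ℝ) : ℂ) := by rw [P.ch_sq]
    push_cast at h ⊢
    rw [bog]
    linear_combination h - P.δ ^ 2 / 4 * P.sh t ^ 2 * Complex.I_sq
  have hη : (P.η : ℂ) = P.ωa + P.ωb + P.δ := by rw [η]; push_cast; ring
  refine ((((P.hasDerivAt_sh t).const_mul (-Complex.I * starRingEnd ℂ P.κ)).mul
    (hasDerivAt_cexp_mul (-(Complex.I * P.η)) t)).div (P.hasDerivAt_bog t) hx).congr_deriv ?_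
  rw [P.conj_coupling, ← neg_mul (Complex.I * P.η) (t : ℂ)]
  simp only [coupling, solA, Pi.mul_apply]
  set E := Complex.exp (-(Complex.I * P.η) * t)
  set F := Complex.exp (Complex.I * P.η * t)
  set D := ((‖P.κ‖ ^ 2 - (P.δ / 2) ^ 2 : ℝ) : ℂ) * P.sh t - Complex.I * (P.δ / 2) * P.ch t
  rw [hη]
  field_simp
  linear_combination (starRingEnd ℂ P.κ * E) * (h2 - h1
    + Complex.I ^ 2 * (starRingEnd ℂ P.κ * P.κ * P.sh t ^ 2) * hE
    + (starRingEnd ℂ P.κ * P.κ * P.sh t ^ 2) * Complex.I_sq)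

theorem Amplifier.bog_deriv_add (P : Amplifier) (t : ℝ) :
    (((‖P.κ‖ ^ 2 - (P.δ / 2) ^ 2 : ℝ) : ℂ) * P.sh t - Complex.I * (P.δ / 2) * P.ch t)
      + Complex.I * (P.δ / 2) * P.bog t = starRingEnd ℂ P.κ * P.κ * P.sh t := by
  rw [conj_mul_self_eq, bog]
  push_cast
  linear_combination -(P.δ ^ 2 / 4 * P.sh t) * Complex.I_sq

theorem Amplifier.coupling_mul_solA (P : Amplifier) (t : ℝ) :
    P.coupling t * P.solA t
      = -Complex.I * (starRingEnd ℂ P.κ * P.κ * P.sh t) / P.bog t := by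
  rw [coupling, solA]
  linear_combination (-Complex.I * (starRingEnd ℂ P.κ * P.κ * P.sh t) / P.bog t)
    * P.exp_mul_exp_neg t

theorem Amplifier.hasDerivAt_solB (P : Amplifier) (ω : ℝ) (ζ : ℂ) (t : ℝ) :
    HasDerivAt (P.solB ω ζ)
      (-Complex.I * (ω * P.solB ω ζ t + P.coupling t * P.solA t * P.solB ω ζ t)) t := by
  have hx := P.bog_ne_zero t
  refine (((hasDerivAt_cexp_mul (-(Complex.I * (ω + P.δ / 2))) t).const_mul ζ).div
    (P.hasDerivAt_bog t) hx).congr_deriv ?_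
  rw [P.coupling_mul_solA, ← P.bog_deriv_add, solB]
  set D := ((‖P.κ‖ ^ 2 - (P.δ / 2) ^ 2 : ℝ) : ℂ) * P.sh t - Complex.I * (P.δ / 2) * P.ch t
  field_simp
  linear_combination (-ζ * (2 * D + Complex.I * P.δ * P.bog t)) * Complex.I_sq

theorem Amplifier.hasDerivAt_solN (P : Amplifier) (ζ ξ : ℂ) (t : ℝ) :
    HasDerivAt (P.solN ζ ξ)
      (-Complex.I * (P.coupling t * (P.solA t + P.solB P.ωa ζ t * P.solB P.ωb ξ t))
        * P.solN ζ ξ t) t := by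
  have hx := P.bog_ne_zero t
  have h1 := P.wronskian t
  have hBC : P.coupling t * (P.solB P.ωa ζ t * P.solB P.ωb ξ t)
      = P.κ * ζ * ξ / P.bog t ^ 2 := by
    have e : Complex.exp (Complex.I * P.η * t)
        * (Complex.exp (-(Complex.I * (P.ωa + P.δ / 2)) * t)
          * Complex.exp (-(Complex.I * (P.ωb + P.δ / 2)) * t)) = 1 := by
      rw [← Complex.exp_add, ← Complex.exp_add, ← Complex.exp_zero]
      congr 1
      rw [η]
      push_cast
      ring
    rw [coupling, solB, solB]
    linear_combination (P.κ * ζ * ξ / P.bog t ^ 2) * e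
  have hS := ((P.hasDerivAt_sh t).div (P.hasDerivAt_bog t) hx).const_mul
    (-(Complex.I * P.κ * ζ * ξ))
  have hexp := (Complex.hasDerivAt_exp (-(Complex.I * P.κ * ζ * ξ) * (P.sh t / P.bog t))).comp t hS
  refine ((((hasDerivAt_cexp_mul (-(Complex.I * (P.δ / 2))) t).div
    (P.hasDerivAt_bog t) hx).mul hexp).const_mul _).congr_deriv ?_
  rw [h1, mul_add (P.coupling t), P.coupling_mul_solA, hBC, ← P.bog_deriv_add, solN]
  set D := ((‖P.κ‖ ^ 2 - (P.δ / 2) ^ 2 : ℝ) : ℂ) * P.sh t - Complex.I * (P.δ / 2) * P.ch t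
  simp only [Function.comp, Pi.div_apply]
  set X := Complex.exp (-(Complex.I * P.κ * ζ * ξ) * (P.sh t / P.bog t))
  field_simp
  linear_combination (-X * P.bog t * (2 * D + Complex.I * P.δ * P.bog t)) * Complex.I_sq

theorem Amplifier.normSq_solA (P : Amplifier) (t : ℝ) :
    Complex.normSq (P.solA t)
      = ‖P.κ‖ ^ 2 * P.sh t ^ 2 / (1 + ‖P.κ‖ ^ 2 * P.sh t ^ 2) := by
  have e : Complex.normSq (Complex.exp (-(Complex.I * P.η) * t)) = 1 := by
    have : -(Complex.I * P.η) * t = ((-(P.η * t) : ℝ) : ℂ) * Complex.I := by push_cast; ring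
    rw [Complex.normSq_eq_norm_sq, this, Complex.norm_exp_ofReal_mul_I, one_pow]
  rw [solA, map_div₀, map_mul, map_mul, map_mul, e, P.normSq_bog]
  simp [Complex.normSq_eq_norm_sq]

theorem Amplifier.norm_solA_lt_one (P : Amplifier) (t : ℝ) : ‖P.solA t‖ < 1 := by
  have h := P.normSq_solA t
  rw [Complex.normSq_eq_norm_sq] at h
  have h2 : ‖P.solA t‖ ^ 2 < 1 := by
    rw [h, div_lt_one (by positivity)]
    linarith
  nlinarith [norm_nonneg (P.solA t)]

/-- The evolved coherent state `U(t) |ζ, ξ⟩` in closed form. -/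
noncomputable def Amplifier.cohEvol (P : Amplifier) (ζ ξ : ℂ) (t : ℝ) : Fock :=
  P.solN ζ ξ t • gaussVec (P.solA t) (P.solB P.ωa ζ t) (P.solB P.ωb ξ t)

theorem Amplifier.cohEvol_zero (P : Amplifier) (ζ ξ : ℂ) : P.cohEvol ζ ξ 0 = coherent ζ ξ := by
  rw [coherent_eq_smul_gaussVec, cohEvol]
  simp [solN, solA, solB]

theorem gaussCoeff_of_neg_left (A B C : ℂ) {m : ℤ} (hm : m < 0) (n : ℤ) :
    gaussCoeff A B C m n = 0 := by
  rw [gaussCoeff_eq_sum A B C n (L := 0) (by simpa using hm)]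
  simp

theorem gaussCoeff_of_neg_right (A B C : ℂ) (m : ℤ) {n : ℤ} (hn : n < 0) :
    gaussCoeff A B C m n = 0 :=
  Finset.sum_eq_zero fun k _ => by rw [dividedPow_of_neg (show n - k < 0 by omega), mul_zero]

/-- `√(m! n!)`, the normalization of the number basis in Bargmann's representation. -/
noncomputable def bargmannWeight (p : ℕ × ℕ) : ℂ :=
  ((√(p.1.factorial : ℝ) * √(p.2.factorial : ℝ) : ℝ) : ℂ)

theorem sqrt_factorial_succ (n : ℕ) :
    √((n + 1).factorial : ℝ) = √((n : ℝ) + 1) * √(n.factorial : ℝ) := by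
  rw [Nat.factorial_succ, Nat.cast_mul, Real.sqrt_mul (by positivity)]
  push_cast
  rfl

theorem bargmannWeight_succ (p : ℕ × ℕ) : ((√(p.1 + 1) * √(p.2 + 1) : ℝ) : ℂ)
    * bargmannWeight (p.1 + 1, p.2 + 1) = (p.1 + 1) * (p.2 + 1) * bargmannWeight p := by
  simp only [bargmannWeight, sqrt_factorial_succ]
  have h1 := Real.mul_self_sqrt (show (0 : ℝ) ≤ (p.1 : ℝ) + 1 by positivity)
  have h2 := Real.mul_self_sqrt (show (0 : ℝ) ≤ (p.2 : ℝ) + 1 by positivity)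
  have e : (√((p.1 : ℝ) + 1) * √((p.2 : ℝ) + 1)) * ((√((p.1 : ℝ) + 1) * √(p.1.factorial : ℝ))
      * (√((p.2 : ℝ) + 1) * √(p.2.factorial : ℝ)))
      = ((p.1 : ℝ) + 1) * ((p.2 : ℝ) + 1) * (√(p.1.factorial : ℝ) * √(p.2.factorial : ℝ)) := by
    linear_combination (√((p.2 : ℝ) + 1) * √((p.2 : ℝ) + 1) * (√(p.1.factorial : ℝ)
      * √(p.2.factorial : ℝ))) * h1 + (((p.1 : ℝ) + 1) * (√(p.1.factorial : ℝ)
      * √(p.2.factorial : ℝ))) * h2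
  exact_mod_cast e

theorem bargmannWeight_pred_mul_gaussCoeff (A B C : ℂ) (p : ℕ × ℕ) :
    ((√p.1 * √p.2 : ℝ) : ℂ) * (bargmannWeight (p.1 - 1, p.2 - 1)
        * gaussCoeff A B C ((p.1 - 1 : ℕ) : ℤ) ((p.2 - 1 : ℕ) : ℤ))
      = bargmannWeight p * gaussCoeff A B C (p.1 - 1) (p.2 - 1) := by
  obtain ⟨m, n⟩ := p
  rcases m with _ | m
  · rw [gaussCoeff_of_neg_left A B C (m := ((0 : ℕ) : ℤ) - 1) (by norm_num)]; simp
  rcases n with _ | n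
  · rw [gaussCoeff_of_neg_right A B C _ (n := ((0 : ℕ) : ℤ) - 1) (by norm_num)]; simp
  simp only [bargmannWeight, sqrt_factorial_succ, Nat.add_sub_cancel, Nat.cast_add, Nat.cast_one,
    add_sub_cancel_right]
  push_cast
  ring

/-- The equations for `A`, `B`, `C`, `N` and the recursions of `gaussCoeff` combine to the
Schrödinger equation. -/
theorem Amplifier.isWeakSolution_cohEvol (P : Amplifier) (ζ ξ : ℂ) :
    P.IsWeakSolution (P.cohEvol ζ ξ) := by
  intro p t
  have hval : ∀ (s : ℝ) (q : ℕ × ℕ), P.cohEvol ζ ξ s q = P.solN ζ ξ s * (bargmannWeight q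
      * gaussCoeff (P.solA s) (P.solB P.ωa ζ s) (P.solB P.ωb ξ s) q.1 q.2) := fun s q => by
    rw [cohEvol, lp.coeFn_smul, Pi.smul_apply, smul_eq_mul, gaussVec_apply (P.norm_solA_lt_one s),
      bargmannWeight]
  have hp := hasDerivAt_gaussCoeff (P.hasDerivAt_solA t) (P.hasDerivAt_solB P.ωa ζ t)
    (P.hasDerivAt_solB P.ωb ξ t) p.1 p.2
  simp only [hval]
  refine ((P.hasDerivAt_solN ζ ξ t).mul (hp.const_mul (bargmannWeight p))).congr_deriv ?_
  have h1 := mul_gaussCoeff_left (P.solA t) (P.solB P.ωa ζ t) (P.solB P.ωb ξ t) p.1 p.2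
  have h2 := mul_gaussCoeff_right (P.solA t) (P.solB P.ωa ζ t) (P.solB P.ωb ξ t) p.1 p.2
  have h3 := mul_mul_gaussCoeff_succ (P.solA t) (P.solB P.ωa ζ t) (P.solB P.ωb ξ t) p.1 p.2
  have h4 := bargmannWeight_pred_mul_gaussCoeff (P.solA t) (P.solB P.ωa ζ t) (P.solB P.ωb ξ t) p
  have h5 := bargmannWeight_succ p
  simp only [generator, hval, Nat.cast_add, Nat.cast_one]
  push_cast at h1 h2 h3 h4 h5 ⊢
  linear_combination (Complex.I * P.solN ζ ξ t * bargmannWeight p) * (P.ωa * h1 + P.ωb * h2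
      + P.coupling t * h3)
    + Complex.I * P.solN ζ ξ t * starRingEnd ℂ (P.coupling t) * h4
    + Complex.I * P.solN ζ ξ t * P.coupling t
      * gaussCoeff (P.solA t) (P.solB P.ωa ζ t) (P.solB P.ωb ξ t) (p.1 + 1) (p.2 + 1) * h5

/-- On a compact time interval `‖A t‖` has a maximum below `1`, so one majorant serves all times. -/
theorem Amplifier.locallyBounded_cohEvol (P : Amplifier) (ζ ξ : ℂ) :
    LocallyBounded (P.cohEvol ζ ξ) := by
  intro T
  rcases lt_or_ge T 0 with hT | hT
  · exact ⟨0, fun s hs => absurd (abs_nonneg s) (by linarith)⟩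
  have cA : Continuous P.solA :=
    continuous_iff_continuousAt.mpr fun t => (P.hasDerivAt_solA t).continuousAt
  have cB : Continuous (P.solB P.ωa ζ) :=
    continuous_iff_continuousAt.mpr fun t => (P.hasDerivAt_solB P.ωa ζ t).continuousAt
  have cC : Continuous (P.solB P.ωb ξ) :=
    continuous_iff_continuousAt.mpr fun t => (P.hasDerivAt_solB P.ωb ξ t).continuousAt
  have cN : Continuous (P.solN ζ ξ) :=
    continuous_iff_continuousAt.mpr fun t => (P.hasDerivAt_solN ζ ξ t).continuousAt
  obtain ⟨t₀, -, ht₀⟩ := (isCompact_Icc (a := -T) (b := T)).exists_isMaxOn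
    ⟨0, by constructor <;> linarith⟩ cA.norm.continuousOn
  obtain ⟨b, hb⟩ := (isCompact_Icc (a := -T) (b := T)).exists_bound_of_continuousOn
    cB.continuousOn
  obtain ⟨c, hc⟩ := (isCompact_Icc (a := -T) (b := T)).exists_bound_of_continuousOn
    cC.continuousOn
  obtain ⟨n, hn⟩ := (isCompact_Icc (a := -T) (b := T)).exists_bound_of_continuousOn
    cN.continuousOn
  refine ⟨n * ∑' q, gaussMajorant ‖P.solA t₀‖ b c q, fun s hs => ?_⟩
  have hs' : s ∈ Set.Icc (-T) T := abs_le.mp hs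
  rw [cohEvol, norm_smul]
  exact mul_le_mul (hn s hs') (norm_gaussVec_le (ht₀ hs') (P.norm_solA_lt_one t₀) (hb s hs')
    (hc s hs')) (norm_nonneg _) ((norm_nonneg _).trans (hn s hs'))

theorem Amplifier.inner_coherent_cohEvol (P : Amplifier) (ζ ξ α β : ℂ) (t : ℝ) :
    inner ℂ (coherent α β) (P.cohEvol ζ ξ t)
      = P.solN ζ ξ t * Complex.exp (-(((‖α‖ ^ 2 + ‖β‖ ^ 2) / 2 : ℝ) : ℂ)
          + P.solA t * (starRingEnd ℂ α * starRingEnd ℂ β) + P.solB P.ωa ζ t * starRingEnd ℂ α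
          + P.solB P.ωb ξ t * starRingEnd ℂ β) := by
  rw [cohEvol, inner_smul_right, inner_coherent_gaussVec (P.norm_solA_lt_one t)]

/-! ### Coherent states are total -/

theorem coeff_eq_zero_of_hasSum {a : ℕ → ℂ}
    (h : ∀ x : ℂ, HasSum (fun n => a n * x ^ n) 0) (n : ℕ) : a n = 0 := by
  have hp : HasFPowerSeriesAt (0 : ℂ → ℂ) (FormalMultilinearSeries.ofScalars ℂ a) 0 := by
    rw [hasFPowerSeriesAt_iff]
    refine Filter.Eventually.of_forall fun z => ?_
    simpa [FormalMultilinearSeries.coeff_ofScalars, mul_comm] using h z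
  have h0 := hp.eq_zero
  rw [← FormalMultilinearSeries.coeff_ofScalars (p := a) (n := n), h0]
  rfl

theorem coeff_eq_zero_of_hasSum₂ {d : ℕ × ℕ → ℂ}
    (h : ∀ x y : ℂ, HasSum (fun p : ℕ × ℕ => d p * (x ^ p.1 * y ^ p.2)) 0) (p : ℕ × ℕ) :
    d p = 0 := by
  obtain ⟨m, n⟩ := p
  have hs : ∀ (m : ℕ) (y : ℂ), Summable fun n => d (m, n) * y ^ n := fun m y => by
    simpa using (h 1 y).summable.prod_factor m
  have h1 : ∀ (y : ℂ) (m : ℕ), ∑' n, d (m, n) * y ^ n = 0 := fun y =>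
    coeff_eq_zero_of_hasSum fun x => (h x y).prod_fiberwise fun m => by
      have := (hs m y).hasSum.mul_right (x ^ m)
      refine this.congr_fun fun n => ?_
      ring
  exact coeff_eq_zero_of_hasSum (a := fun n => d (m, n))
    (fun y => (h1 y m) ▸ (hs m y).hasSum) n

/-- Up to a Gaussian factor the inner products with coherent states are an entire function of two
variables, whose Taylor coefficients determine the state. -/
theorem eq_zero_of_inner_coherent_eq_zero {v : Fock}
    (h : ∀ α β : ℂ, inner ℂ (coherent α β) v = 0) : v = 0 := by
  have hw : ∀ p : ℕ × ℕ, bargmannWeight p ≠ 0 := fun p => by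
    rw [bargmannWeight, Complex.ofReal_ne_zero]
    positivity
  have hd : ∀ p : ℕ × ℕ, v p / bargmannWeight p = 0 := by
    refine coeff_eq_zero_of_hasSum₂ fun x y => ?_
    have h1 := lp.hasSum_inner (𝕜 := ℂ) (coherent (starRingEnd ℂ x) (starRingEnd ℂ y)) v
    rw [h] at h1
    have e0 : ((Real.exp (-‖x‖ ^ 2 / 2) * Real.exp (-‖y‖ ^ 2 / 2) : ℝ) : ℂ) ≠ 0 := by
      rw [Complex.ofReal_ne_zero]; positivity
    have h2 := hasSum_const_mul_complex
      ((Real.exp (-‖x‖ ^ 2 / 2) * Real.exp (-‖y‖ ^ 2 / 2) : ℝ) : ℂ)⁻¹ h1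
    rw [mul_zero] at h2
    refine h2.congr_fun fun p => ?_
    change _ = _ * (v p * starRingEnd ℂ (coherentCoeff (starRingEnd ℂ x) (starRingEnd ℂ y) p))
    rw [eq_inv_mul_iff_mul_eq₀ e0]
    simp only [coherentCoeff, bargmannWeight, RCLike.norm_conj, map_mul, map_div₀, map_pow,
      Complex.conj_conj, Complex.conj_ofReal, Complex.ofReal_mul]
    simp only [div_eq_mul_inv, mul_inv]
    ring
  ext p
  simpa [hw p] using hd p

/-- Finite linear combinations of coherent states, as a linear map. -/
noncomputable def coherentCombination : (ℂ × ℂ →₀ ℂ) →ₗ[ℂ] Fock :=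
  Finsupp.linearCombination ℂ (fun z : ℂ × ℂ => coherent z.1 z.2)

theorem denseRange_coherentCombination : DenseRange coherentCombination := by
  have h : (LinearMap.range coherentCombination).topologicalClosure = ⊤ := by
    rw [Submodule.topologicalClosure_eq_top_iff, Submodule.eq_bot_iff]
    intro v hv
    refine eq_zero_of_inner_coherent_eq_zero fun α β => ?_
    refine (Submodule.mem_orthogonal _ _).mp hv _ ⟨Finsupp.single (α, β) 1, ?_⟩
    simp [coherentCombination, Finsupp.linearCombination_single]
  have h' := (Submodule.dense_iff_topologicalClosure_eq_top).mpr h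
  rwa [LinearMap.coe_range] at h'

/-! ### The time-evolution operator -/

/-- Evolution of finite linear combinations of coherent states. -/
noncomputable def Amplifier.combinationEvol (P : Amplifier) (t : ℝ) : (ℂ × ℂ →₀ ℂ) →ₗ[ℂ] Fock :=
  Finsupp.linearCombination ℂ (fun z : ℂ × ℂ => P.cohEvol z.1 z.2 t)

theorem Amplifier.combinationEvol_zero (P : Amplifier) :
    P.combinationEvol 0 = coherentCombination := by
  simp only [combinationEvol, coherentCombination, cohEvol_zero]

theorem Amplifier.combinationEvol_spec (P : Amplifier) (f : ℂ × ℂ →₀ ℂ) :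
    P.IsWeakSolution (fun t => P.combinationEvol t f)
      ∧ LocallyBounded (fun t => P.combinationEvol t f) := by
  induction f using Finsupp.induction_linear with
  | zero =>
    simp only [map_zero]
    refine ⟨fun p t => ?_, fun T => ⟨0, fun s _ => by simp⟩⟩
    simpa [generator] using hasDerivAt_const t (0 : ℂ)
  | add f g hf hg =>
    simp only [map_add]
    exact ⟨hf.1.add hg.1, hf.2.add hg.2⟩
  | single z a =>
    simp only [combinationEvol, Finsupp.linearCombination_single]
    exact ⟨(P.isWeakSolution_cohEvol z.1 z.2).const_smul a,
      (P.locallyBounded_cohEvol z.1 z.2).const_smul a⟩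

theorem Amplifier.norm_combinationEvol (P : Amplifier) (t : ℝ) (f : ℂ × ℂ →₀ ℂ) :
    ‖P.combinationEvol t f‖ = ‖coherentCombination f‖ := by
  have h := P.combinationEvol_spec f
  rw [← P.combinationEvol_zero]
  exact h.1.norm_eq h.2 0 t

/-- The time-evolution operator: the continuous extension of the evolution of linear combinations
of coherent states. -/
noncomputable def Amplifier.evolution (P : Amplifier) (t : ℝ) : Fock →L[ℂ] Fock :=
  (P.combinationEvol t).extendOfNorm coherentCombination

theorem Amplifier.evolution_combination (P : Amplifier) (t : ℝ) (f : ℂ × ℂ →₀ ℂ) :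
    P.evolution t (coherentCombination f) = P.combinationEvol t f :=
  LinearMap.extendOfNorm_eq denseRange_coherentCombination
    ⟨1, fun f => by rw [one_mul, P.norm_combinationEvol]⟩ f

theorem Amplifier.norm_evolution_le (P : Amplifier) (t : ℝ) (ψ : Fock) :
    ‖P.evolution t ψ‖ ≤ ‖ψ‖ := by
  exact (LinearMap.norm_extendOfNorm_apply_le denseRange_coherentCombination 1
    (fun f => by rw [one_mul, P.norm_combinationEvol t f]) ψ).trans_eq (one_mul _)

theorem Amplifier.evolution_zero (P : Amplifier) : P.evolution 0 = 1 := by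
  refine LinearMap.extendOfNorm_unique denseRange_coherentCombination 1
    (fun f => by rw [one_mul, P.norm_combinationEvol]) 1 ?_
  rw [P.combinationEvol_zero]
  rfl

theorem Amplifier.norm_generator_le (P : Amplifier) (t : ℝ) (x : Fock) (p : ℕ × ℕ) :
    ‖P.generator t x p‖ ≤ (‖(P.ωa * p.1 + P.ωb * p.2 : ℂ)‖
      + ‖P.κ‖ * (√(p.1 + 1) * √(p.2 + 1)) + ‖P.κ‖ * (√p.1 * √p.2)) * ‖x‖ := by
  have hx : ∀ q, ‖x q‖ ≤ ‖x‖ := fun q => lp.norm_apply_le_norm (by simp) x q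
  rw [generator, norm_mul, norm_neg, Complex.norm_I, one_mul, add_mul (_ + _),
    add_mul ‖_‖]
  refine (norm_add₃_le).trans ?_
  rw [norm_mul, norm_mul, norm_mul, norm_mul, norm_mul, RCLike.norm_conj, P.norm_coupling,
    Complex.norm_real, Complex.norm_real, Real.norm_of_nonneg (by positivity),
    Real.norm_of_nonneg (by positivity)]
  gcongr <;> exact hx _

/-- The generator is bounded coefficient by coefficient, uniformly in time, so the Schrödinger
equation passes from the dense set of combinations of coherent states to all states. -/
theorem Amplifier.isWeakSolution_evolution (P : Amplifier) (ψ : Fock) :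
    P.IsWeakSolution (fun t => P.evolution t ψ) := by
  intro p
  obtain ⟨x, hx, hlim⟩ := mem_closure_iff_seq_limit.mp (denseRange_coherentCombination ψ)
  choose f hf using hx
  have hweak : ∀ n, P.IsWeakSolution (fun t => P.evolution t (x n)) := fun n => by
    simp only [← hf n, P.evolution_combination]
    exact (P.combinationEvol_spec (f n)).1
  set K := ‖(P.ωa * p.1 + P.ωb * p.2 : ℂ)‖
      + ‖P.κ‖ * (√(p.1 + 1) * √(p.2 + 1)) + ‖P.κ‖ * (√p.1 * √p.2) with hK
  have hK0 : 0 ≤ K := by positivity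
  have hlim0 : Filter.Tendsto (fun n => K * ‖ψ - x n‖) Filter.atTop (nhds 0) := by
    have : Filter.Tendsto (fun n => ψ - x n) Filter.atTop (nhds (ψ - ψ)) := hlim.const_sub ψ
    simpa using this.norm.const_mul K
  refine hasDerivAt_of_tendstoUniformly (l := Filter.atTop)
    (f := fun n t => P.evolution t (x n) p)
    (f' := fun n t => P.generator t (P.evolution t (x n)) p) ?_
    (Filter.Eventually.of_forall fun n t => hweak n p t) ?_
  · rw [Metric.tendstoUniformly_iff]
    intro ε hε
    filter_upwards [(tendsto_order.mp hlim0).2 ε hε] with n hn t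
    have e : P.generator t (P.evolution t ψ) p - P.generator t (P.evolution t (x n)) p
        = P.generator t (P.evolution t (ψ - x n)) p := by
      rw [map_sub, lp.coeFn_sub, sub_eq_add_neg (P.evolution t ψ : ℕ × ℕ → ℂ), ← neg_one_smul ℂ
        (P.evolution t (x n) : ℕ × ℕ → ℂ), P.generator_add, P.generator_smul]
      ring
    rw [dist_eq_norm, e]
    refine lt_of_le_of_lt ((P.norm_generator_le t _ p).trans ?_) hn
    exact mul_le_mul_of_nonneg_left (P.norm_evolution_le t _) hK0
  · intro t
    have h1 : Continuous fun y : Fock => lp.evalCLM ℂ (fun _ : ℕ × ℕ => ℂ) 2 p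
      (P.evolution t y) := by fun_prop
    exact (h1.tendsto ψ).comp hlim

theorem Amplifier.locallyBounded_evolution (P : Amplifier) (ψ : Fock) :
    LocallyBounded (fun t => P.evolution t ψ) :=
  fun _ => ⟨‖ψ‖, fun s _ => P.norm_evolution_le s ψ⟩

theorem Amplifier.norm_evolution (P : Amplifier) (t : ℝ) (ψ : Fock) :
    ‖P.evolution t ψ‖ = ‖ψ‖ := by
  have h := (P.isWeakSolution_evolution ψ).norm_eq (P.locallyBounded_evolution ψ) 0 t
  simpa [P.evolution_zero] using h

/-- The amplifier whose Hamiltonian is `s ↦ H (s + τ)`: a translation in time only changes the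
phase of the coupling. -/
noncomputable def Amplifier.shift (P : Amplifier) (τ : ℝ) : Amplifier where
  ωa := P.ωa
  ωb := P.ωb
  δ := P.δ
  κ := P.κ * Complex.exp (Complex.I * P.η * τ)

theorem Amplifier.coupling_shift (P : Amplifier) (τ s : ℝ) :
    (P.shift τ).coupling s = P.coupling (s + τ) := by
  have e : (P.shift τ).η = P.η := rfl
  rw [coupling, coupling, e, shift, mul_assoc, ← Complex.exp_add]
  push_cast
  congr 2
  ring

theorem Amplifier.generator_shift (P : Amplifier) (τ s : ℝ) (c : ℕ × ℕ → ℂ) (p : ℕ × ℕ) :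
    (P.shift τ).generator s c p = P.generator (s + τ) c p := by
  rw [generator, generator, P.coupling_shift]
  rfl

/-- Evolving back from time `t` with the shifted amplifier inverts the evolution. -/
theorem Amplifier.evolution_surjective (P : Amplifier) (t : ℝ) :
    Function.Surjective (P.evolution t) := by
  intro ψ
  refine ⟨(P.shift t).evolution (-t) ψ, ?_⟩
  have h : P.IsWeakSolution (fun s => (P.shift t).evolution (s - t) ψ) := fun p s => by
    have h1 := ((P.shift t).isWeakSolution_evolution ψ p (s - t)).comp_sub_const s t
    rwa [generator_shift, sub_add_cancel] at h1
  have h2 := (P.isWeakSolution_evolution ((P.shift t).evolution (-t) ψ)).eq_of_eq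
    (P.locallyBounded_evolution _) h (fun T => ⟨‖ψ‖, fun s _ => norm_evolution_le _ _ ψ⟩)
    (t₀ := 0) (by simp [evolution_zero]) t
  rw [h2, sub_self, evolution_zero, one_apply_eq_self]

theorem Amplifier.evolution_mem_unitary (P : Amplifier) (t : ℝ) :
    P.evolution t ∈ unitary (Fock →L[ℂ] Fock) := by
  have h1 : star (P.evolution t) * P.evolution t = 1 :=
    (P.evolution t).norm_map_iff_adjoint_comp_self.mp (P.norm_evolution t)
  refine Unitary.mem_iff.mpr ⟨h1, ?_⟩
  ext1 ψ
  obtain ⟨χ, rfl⟩ := P.evolution_surjective t ψ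
  have := congrArg (fun V => P.evolution t (V χ)) h1
  simpa using this

theorem Amplifier.isTimeEvolution_evolution (P : Amplifier) : P.IsTimeEvolution P.evolution where
  isUnitary := P.evolution_mem_unitary
  initial := P.evolution_zero
  schrodinger ψ := (P.isWeakSolution_iff _).mp (P.isWeakSolution_evolution ψ)

/-- A time-evolution operator produces the only locally bounded weak solution with the given initial
state. -/
theorem Amplifier.IsTimeEvolution.apply_eq {P : Amplifier} {U : ℝ → Fock →L[ℂ] Fock}
    (hU : P.IsTimeEvolution U) {ψ : Fock} {c : ℝ → Fock} (hc : P.IsWeakSolution c)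
    (hb : LocallyBounded c) (h0 : c 0 = ψ) (t : ℝ) : U t ψ = c t := by
  refine Amplifier.IsWeakSolution.eq_of_eq ((P.isWeakSolution_iff _).mpr (hU.schrodinger ψ))
    (fun T => ⟨‖ψ‖, fun s _ => ?_⟩) hc hb (t₀ := 0) ?_ t
  · exact (ContinuousLinearMap.norm_map_of_mem_unitary (hU.isUnitary s) ψ).le
  · rw [hU.initial, h0, one_apply_eq_self]

theorem Amplifier.existsUnique_isTimeEvolution (P : Amplifier) :
    ∃! U : ℝ → Fock →L[ℂ] Fock, P.IsTimeEvolution U := by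
  refine ⟨P.evolution, P.isTimeEvolution_evolution, fun V hV => ?_⟩
  funext t
  ext1 ψ
  exact hV.apply_eq (P.isWeakSolution_evolution ψ) (P.locallyBounded_evolution ψ)
    (by simp [P.evolution_zero]) t

theorem Amplifier.IsTimeEvolution.apply_coherent {P : Amplifier} {U : ℝ → Fock →L[ℂ] Fock}
    (hU : P.IsTimeEvolution U) (ζ ξ : ℂ) (t : ℝ) : U t (coherent ζ ξ) = P.cohEvol ζ ξ t :=
  hU.apply_eq (P.isWeakSolution_cohEvol ζ ξ) (P.locallyBounded_cohEvol ζ ξ) (P.cohEvol_zero ζ ξ) t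

/-! ### Gaussian integrals over `ℂ` and `ℂ × ℂ` -/

theorem ofReal_gaussian (p : ℝ) (h z : ℂ) :
    ((Real.exp (-(p * ‖z‖ ^ 2) + 2 * (h * z).re) : ℝ) : ℂ)
      = Complex.exp (-(p : ℂ) * ‖z‖ ^ 2 + 2 * (inner ℝ (starRingEnd ℂ h) z : ℝ)) := by
  rw [Complex.inner, Complex.conj_conj, mul_comm h z]
  push_cast
  congr 1
  ring

theorem integrable_gaussian {p : ℝ} (hp : 0 < p) (h : ℂ) :
    Integrable fun z : ℂ => Real.exp (-(p * ‖z‖ ^ 2) + 2 * (h * z).re) := by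
  have := GaussianFourier.integrable_cexp_neg_mul_sq_norm_add (b := (p : ℂ)) (by simpa using hp)
    2 (starRingEnd ℂ h)
  simp only [← ofReal_gaussian] at this
  simpa only [RCLike.re_to_complex, Complex.ofReal_re] using this.re

theorem integral_gaussian_complex {p : ℝ} (hp : 0 < p) (h : ℂ) :
    ∫ z : ℂ, Real.exp (-(p * ‖z‖ ^ 2) + 2 * (h * z).re)
      = Real.pi / p * Real.exp (‖h‖ ^ 2 / p) := by
  have := GaussianFourier.integral_cexp_neg_mul_sq_norm_add (b := (p : ℂ)) (by simpa using hp)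
    2 (starRingEnd ℂ h)
  simp only [← ofReal_gaussian, integral_complex_ofReal, Complex.finrank_real_complex,
    RCLike.norm_conj] at this
  have e : ((Real.pi : ℂ) / p) ^ (((2 : ℕ) : ℂ) / 2) = Real.pi / p := by norm_num
  rw [e] at this
  have e2 : ((2 : ℂ) ^ 2 * (‖h‖ : ℂ) ^ 2 / (4 * p)) = ((‖h‖ ^ 2 / p : ℝ) : ℂ) := by
    push_cast
    rw [show (2 : ℂ) ^ 2 = 4 by norm_num, mul_div_mul_left _ _ (by norm_num)]
  rw [e2] at this
  exact_mod_cast this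

/-- Exponent of a Gaussian on `ℂ × ℂ` with an anomalous coupling `e` of the two variables. -/
noncomputable def gaussExponent (p q : ℝ) (g h e : ℂ) (z : ℂ × ℂ) : ℝ :=
  -(p * ‖z.1‖ ^ 2 + q * ‖z.2‖ ^ 2) + 2 * (g * z.1 + h * z.2 + e * (z.1 * z.2)).re

theorem norm_add_mul_sq (h e z : ℂ) :
    ‖h + e * z‖ ^ 2 = ‖h‖ ^ 2 + ‖e‖ ^ 2 * ‖z‖ ^ 2 + 2 * (starRingEnd ℂ h * e * z).re := by
  rw [← Complex.normSq_eq_norm_sq, ← Complex.normSq_eq_norm_sq, ← Complex.normSq_eq_norm_sq,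
    ← Complex.normSq_eq_norm_sq]
  simp only [Complex.normSq_apply, Complex.add_re, Complex.mul_re, Complex.add_im, Complex.mul_im,
    Complex.conj_re, Complex.conj_im]
  ring

theorem exp_gaussExponent (p q : ℝ) (g h e : ℂ) (x y : ℂ) :
    Real.exp (gaussExponent p q g h e (x, y))
      = Real.exp (-(p * ‖x‖ ^ 2) + 2 * (g * x).re)
        * Real.exp (-(q * ‖y‖ ^ 2) + 2 * ((h + e * x) * y).re) := by
  rw [← Real.exp_add, gaussExponent]
  congr 1
  simp only [Complex.add_re, add_mul, mul_assoc]
  ring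

/-- Completing the square in the second variable leaves a Gaussian in the first one, with `p`
lowered to `p - ‖e‖² / q`. -/
theorem integral_gaussExponent_fiber {q : ℝ} (p : ℝ) (hq : 0 < q) (g h e x : ℂ) :
    ∫ y : ℂ, Real.exp (gaussExponent p q g h e (x, y))
      = Real.pi / q * Real.exp (‖h‖ ^ 2 / q) * Real.exp (-((p - ‖e‖ ^ 2 / q) * ‖x‖ ^ 2)
        + 2 * ((g + starRingEnd ℂ h * e / q) * x).re) := by
  simp only [exp_gaussExponent]
  rw [integral_const_mul, integral_gaussian_complex hq, norm_add_mul_sq]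
  have e1 : ((g + starRingEnd ℂ h * e / q) * x).re
      = (g * x).re + (starRingEnd ℂ h * e * x).re / q := by
    rw [add_mul, Complex.add_re, div_mul_eq_mul_div, Complex.div_ofReal_re]
  have e2 : ∀ a b c d : ℝ,
      Real.exp a * (d * Real.exp b) = d * Real.exp c * Real.exp (a + b - c) := by
    intro a b c d
    rw [mul_assoc, ← Real.exp_add, mul_left_comm, ← Real.exp_add]
    congr 2
    ring
  rw [e1, e2 _ _ (‖h‖ ^ 2 / q)]
  congr 2
  ring

theorem continuous_gaussExponent (p q : ℝ) (g h e : ℂ) :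
    Continuous (gaussExponent p q g h e) := by
  unfold gaussExponent
  fun_prop

theorem integrable_gaussExponent {p q : ℝ} {e : ℂ} (hq : 0 < q) (he : ‖e‖ ^ 2 < p * q)
    (g h : ℂ) : Integrable fun z : ℂ × ℂ => Real.exp (gaussExponent p q g h e z) := by
  have hc : Continuous fun z : ℂ × ℂ => Real.exp (gaussExponent p q g h e z) :=
    Real.continuous_exp.comp (continuous_gaussExponent p q g h e)
  rw [Measure.volume_eq_prod, integrable_prod_iff hc.aestronglyMeasurable]
  constructor
  · refine Filter.Eventually.of_forall fun x => ?_
    simp only [exp_gaussExponent]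
    exact (integrable_gaussian hq _).const_mul _
  · simp only [Real.norm_of_nonneg (Real.exp_nonneg _), integral_gaussExponent_fiber p hq]
    refine (integrable_gaussian ?_ _).const_mul _
    rw [sub_pos, div_lt_iff₀ hq]
    exact he

theorem integral_gaussExponent {p q : ℝ} {e : ℂ} (hq : 0 < q) (he : ‖e‖ ^ 2 < p * q) (g h : ℂ) :
    ∫ z : ℂ × ℂ, Real.exp (gaussExponent p q g h e z)
      = Real.pi ^ 2 / (p * q - ‖e‖ ^ 2) * Real.exp ((q * ‖g‖ ^ 2 + p * ‖h‖ ^ 2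
        + 2 * (e * (starRingEnd ℂ g * starRingEnd ℂ h)).re) / (p * q - ‖e‖ ^ 2)) := by
  have hd : 0 < p * q - ‖e‖ ^ 2 := sub_pos.mpr he
  have hp' : 0 < p - ‖e‖ ^ 2 / q := by rw [sub_pos, div_lt_iff₀ hq]; exact he
  have hi := integrable_gaussExponent hq he g h
  rw [Measure.volume_eq_prod] at hi ⊢
  rw [integral_prod _ hi]
  simp only [integral_gaussExponent_fiber p hq]
  rw [integral_const_mul, integral_gaussian_complex hp']
  have e1 : ‖g + starRingEnd ℂ h * e / q‖ ^ 2 = ‖g‖ ^ 2 + ‖h‖ ^ 2 * ‖e‖ ^ 2 / q ^ 2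
      + 2 * (e * (starRingEnd ℂ g * starRingEnd ℂ h)).re / q := by
    have := norm_add_mul_sq g (starRingEnd ℂ h * e) ((q⁻¹ : ℝ) : ℂ)
    rw [show g + starRingEnd ℂ h * e / q = g + starRingEnd ℂ h * e * ((q⁻¹ : ℝ) : ℂ) by
      push_cast; ring, this, norm_mul, RCLike.norm_conj, Complex.norm_real,
      Real.norm_of_nonneg (by positivity), Complex.re_mul_ofReal,
      show starRingEnd ℂ g * (starRingEnd ℂ h * e) = e * (starRingEnd ℂ g * starRingEnd ℂ h) by
        ring]
    field_simp
  rw [e1]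
  have e2 : p - ‖e‖ ^ 2 / q = (p * q - ‖e‖ ^ 2) / q := by field_simp
  have e3 : ∀ a b c d : ℝ, a * Real.exp b * (c * Real.exp d) = a * c * Real.exp (b + d) := by
    intro a b c d; rw [Real.exp_add]; ring
  rw [e2, e3]
  congr 1
  · field_simp
  · congr 1
    have hd' := hd.ne'
    have hpq : p * q = p * q - ‖e‖ ^ 2 + ‖e‖ ^ 2 := by ring
    generalize p * q - ‖e‖ ^ 2 = d at hd' hpq ⊢
    field_simp
    linear_combination (-‖h‖ ^ 2) * hpq

/-! ### The Husimi function of the evolved thermal state -/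

theorem Amplifier.G_eq (P : Amplifier) (na nb x y t : ℝ) : P.G na nb x y t
    = (na * x + 1) * (nb * y + 1) + (na + nb + 1) * (‖P.κ‖ ^ 2 * P.sh t ^ 2) := by
  rw [G, ← P.ofReal_sh]
  norm_cast

theorem inner_coherent_coherent (α β ζ ξ : ℂ) :
    inner ℂ (coherent α β) (coherent ζ ξ)
      = Complex.exp (-(((‖ζ‖ ^ 2 + ‖ξ‖ ^ 2) / 2 : ℝ) : ℂ)) * Complex.exp
        (-(((‖α‖ ^ 2 + ‖β‖ ^ 2) / 2 : ℝ) : ℂ) + ζ * starRingEnd ℂ α + ξ * starRingEnd ℂ β) := by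
  rw [coherent_eq_smul_gaussVec ζ ξ, inner_smul_right, inner_coherent_gaussVec (by simp)]
  simp

theorem norm_coherent (α β : ℂ) : ‖coherent α β‖ = 1 := by
  have h := inner_coherent_coherent α β α β
  rw [← Complex.exp_add, inner_self_eq_norm_sq_to_K, mul_comm α, mul_comm β, conj_mul_self_eq,
    conj_mul_self_eq] at h
  have e : -(((‖α‖ ^ 2 + ‖β‖ ^ 2) / 2 : ℝ) : ℂ) + (-(((‖α‖ ^ 2 + ‖β‖ ^ 2) / 2 : ℝ) : ℂ)
      + ((‖α‖ ^ 2 : ℝ) : ℂ) + ((‖β‖ ^ 2 : ℝ) : ℂ)) = 0 := by push_cast; ring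
  rw [e, Complex.exp_zero] at h
  have h' : ‖coherent α β‖ ^ 2 = 1 := by simpa [← Complex.ofReal_pow] using congrArg Complex.re h
  exact (pow_eq_one_iff_of_nonneg (norm_nonneg _) two_ne_zero).mp h'

theorem continuous_coherent : Continuous fun z : ℂ × ℂ => coherent z.1 z.2 := by
  refine continuous_iff_continuousAt.mpr fun z₀ => ?_
  rw [ContinuousAt, tendsto_iff_norm_sub_tendsto_zero]
  have h1 : ∀ z : ℂ × ℂ, ‖coherent z.1 z.2 - coherent z₀.1 z₀.2‖
      = √(2 - 2 * RCLike.re (inner ℂ (coherent z.1 z.2) (coherent z₀.1 z₀.2))) := fun z => by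
    rw [← Real.sqrt_sq (norm_nonneg (coherent z.1 z.2 - coherent z₀.1 z₀.2)),
      norm_sub_sq (𝕜 := ℂ), norm_coherent, norm_coherent]
    congr 1
    ring
  have h2 : Continuous fun z : ℂ × ℂ =>
      √(2 - 2 * RCLike.re (inner ℂ (coherent z.1 z.2) (coherent z₀.1 z₀.2))) := by
    simp only [inner_coherent_coherent]
    fun_prop
  have h3 := h2.tendsto z₀
  simp only [h1]
  rw [inner_self_eq_norm_sq (𝕜 := ℂ), norm_coherent] at h3
  simpa using h3

/-- The Bochner integral defining the thermal state converges absolutely in operator norm. -/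
theorem integrable_thermal {na nb : ℝ} (ha : 0 < na) (hb : 0 < nb) :
    Integrable fun ζ : ℂ × ℂ =>
      (Real.exp (-(na⁻¹ * ‖ζ.1‖ ^ 2 + nb⁻¹ * ‖ζ.2‖ ^ 2)) / Real.pi ^ 2) •
        InnerProductSpace.rankOne ℂ (coherent ζ.1 ζ.2) (coherent ζ.1 ζ.2) := by
  have h0 := (integrable_gaussExponent (p := na⁻¹) (q := nb⁻¹) (e := 0) (by positivity)
    (by simp; positivity) 0 0).div_const (Real.pi ^ 2)
  simp only [gaussExponent, zero_mul, add_zero, Complex.zero_re, mul_zero] at h0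
  refine h0.mono' ?_ (Filter.Eventually.of_forall fun ζ => ?_)
  · have h1 : Continuous fun ζ : ℂ × ℂ =>
        Real.exp (-(na⁻¹ * ‖ζ.1‖ ^ 2 + nb⁻¹ * ‖ζ.2‖ ^ 2)) / Real.pi ^ 2 := by fun_prop
    have h2 : Continuous fun ζ : ℂ × ℂ =>
        InnerProductSpace.rankOne ℂ (coherent ζ.1 ζ.2) (coherent ζ.1 ζ.2) :=
      (ContinuousLinearMap.smulRightL ℂ Fock Fock).continuous₂.comp
        (((innerSL ℂ).continuous.comp continuous_coherent).prodMk continuous_coherent)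
    exact (h1.smul h2).aestronglyMeasurable
  · rw [norm_smul, InnerProductSpace.norm_rankOne, norm_coherent, Real.norm_of_nonneg
      (by positivity)]
    simp

/-- Expansion of the Husimi function over the coherent-state mixture defining the thermal
state. -/
theorem husimi_evolve_thermalState {na nb : ℝ} (ha : 0 < na) (hb : 0 < nb) (V : Fock →L[ℂ] Fock)
    (α β : ℂ) : husimi (evolve V (thermalState na nb)) α β
      = 1 / (na * nb) * ∫ ζ : ℂ × ℂ,
        Real.exp (-(na⁻¹ * ‖ζ.1‖ ^ 2 + nb⁻¹ * ‖ζ.2‖ ^ 2)) / Real.pi ^ 2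
          * ‖inner ℂ (coherent α β) (V (coherent ζ.1 ζ.2))‖ ^ 2 := by
  have hi := integrable_thermal ha hb
  set ψ := coherent α β
  have hi2 := hi.apply_continuousLinearMap (star V ψ)
  have hi3 := V.integrable_comp hi2
  have h1 : (inner ℂ ψ (evolve V (thermalState na nb) ψ) : ℂ)
      = ((1 / (na * nb) : ℝ) : ℂ) * ∫ ζ : ℂ × ℂ,
        ((Real.exp (-(na⁻¹ * ‖ζ.1‖ ^ 2 + nb⁻¹ * ‖ζ.2‖ ^ 2)) / Real.pi ^ 2
          * ‖inner ℂ ψ (V (coherent ζ.1 ζ.2))‖ ^ 2 : ℝ) : ℂ) := by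
    change inner ℂ ψ (V (thermalState na nb (star V ψ))) = _
    have hs : ∀ (r : ℝ) (x : Fock), r • x = (r : ℂ) • x := fun r x =>
      RCLike.real_smul_eq_coe_smul r x
    rw [thermalState, smul_apply, ContinuousLinearMap.integral_apply hi,
      hs, map_smul, inner_smul_right, ← V.integral_comp_comm hi2,
      ← integral_inner hi3]
    congr 1
    refine integral_congr_ae (Filter.Eventually.of_forall fun ζ => ?_)
    simp only [smul_apply, InnerProductSpace.rankOne_apply]
    rw [hs, map_smul, map_smul, inner_smul_right, inner_smul_right,
      ContinuousLinearMap.star_eq_adjoint, ContinuousLinearMap.adjoint_inner_right,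
      ← inner_conj_symm (V _) ψ, conj_mul_self_eq]
    push_cast
    rfl
  rw [husimi, h1, integral_complex_ofReal, ← Complex.ofReal_mul, Complex.ofReal_re]

theorem norm_exp_sq (z : ℂ) : ‖Complex.exp z‖ ^ 2 = Real.exp (2 * z.re) := by
  rw [Complex.norm_exp, ← Real.exp_nat_mul]
  norm_num

/-- The coefficient of `ζ` (for `ω = ωa`) or `ξ` (for `ω = ωb`) in the exponent of
`⟨α, β| U(t) |ζ, ξ⟩`. -/
noncomputable def Amplifier.linCoeff (P : Amplifier) (ω : ℝ) (α : ℂ) (t : ℝ) : ℂ :=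
  Complex.exp (-(Complex.I * (ω + P.δ / 2)) * t) * starRingEnd ℂ α / P.bog t

/-- The coefficient of `ζ ξ` in the exponent of `⟨α, β| U(t) |ζ, ξ⟩`. -/
noncomputable def Amplifier.quadCoeff (P : Amplifier) (t : ℝ) : ℂ :=
  -(Complex.I * P.κ * P.sh t) / P.bog t

theorem norm_cexp_neg_I_mul (x t : ℝ) : ‖Complex.exp (-(Complex.I * x) * t)‖ = 1 := by
  rw [show -(Complex.I * x) * t = ((-(x * t) : ℝ) : ℂ) * Complex.I by push_cast; ring,
    Complex.norm_exp_ofReal_mul_I]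

theorem Amplifier.norm_bog_sq (P : Amplifier) (t : ℝ) :
    ‖P.bog t‖ ^ 2 = 1 + ‖P.κ‖ ^ 2 * P.sh t ^ 2 := by
  rw [← Complex.normSq_eq_norm_sq, P.normSq_bog]

theorem Amplifier.norm_linCoeff_sq (P : Amplifier) (ω : ℝ) (α : ℂ) (t : ℝ) :
    ‖P.linCoeff ω α t‖ ^ 2 = ‖α‖ ^ 2 / (1 + ‖P.κ‖ ^ 2 * P.sh t ^ 2) := by
  have := norm_cexp_neg_I_mul (ω + P.δ / 2) t
  push_cast at this
  rw [linCoeff, norm_div, norm_mul, this, one_mul, RCLike.norm_conj, div_pow, P.norm_bog_sq]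

theorem Amplifier.norm_quadCoeff_sq (P : Amplifier) (t : ℝ) :
    ‖P.quadCoeff t‖ ^ 2 = ‖P.κ‖ ^ 2 * P.sh t ^ 2 / (1 + ‖P.κ‖ ^ 2 * P.sh t ^ 2) := by
  rw [quadCoeff, norm_div, norm_neg, norm_mul, norm_mul, Complex.norm_I, one_mul, div_pow,
    P.norm_bog_sq, Complex.norm_real, mul_pow, Real.norm_eq_abs, sq_abs]

/-- The transition probability `|⟨α, β| U(t) |ζ, ξ⟩|²` as a Gaussian in `(ζ, ξ)`. -/
theorem Amplifier.norm_inner_cohEvol_sq (P : Amplifier) (α β ζ ξ : ℂ) (t : ℝ) :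
    ‖(inner ℂ (coherent α β) (P.cohEvol ζ ξ t) : ℂ)‖ ^ 2
      = Real.exp (-(‖α‖ ^ 2 + ‖β‖ ^ 2)
          + 2 * (P.solA t * (starRingEnd ℂ α * starRingEnd ℂ β)).re)
        / (1 + ‖P.κ‖ ^ 2 * P.sh t ^ 2)
        * Real.exp (gaussExponent 1 1 (P.linCoeff P.ωa α t) (P.linCoeff P.ωb β t)
          (P.quadCoeff t) (ζ, ξ)) := by
  have h := norm_cexp_neg_I_mul (P.δ / 2) t
  push_cast at h
  have e1 : (inner ℂ (coherent α β) (P.cohEvol ζ ξ t) : ℂ)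
      = Complex.exp (-(Complex.I * (P.δ / 2)) * t) / P.bog t
        * Complex.exp (-(((‖ζ‖ ^ 2 + ‖ξ‖ ^ 2) / 2 : ℝ) : ℂ) + -(((‖α‖ ^ 2 + ‖β‖ ^ 2) / 2 : ℝ) : ℂ)
          + P.solA t * (starRingEnd ℂ α * starRingEnd ℂ β)
          + (P.linCoeff P.ωa α t * ζ + P.linCoeff P.ωb β t * ξ + P.quadCoeff t * (ζ * ξ))) := by
    rw [inner_coherent_cohEvol, solN]
    have e2 : ∀ a b c d : ℂ, Complex.exp a * (b * Complex.exp c) * Complex.exp d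
        = b * Complex.exp (a + c + d) := by
      intro a b c d; rw [Complex.exp_add, Complex.exp_add]; ring
    rw [e2]
    congr 2
    rw [solB, solB, linCoeff, linCoeff, quadCoeff]
    ring
  rw [e1, norm_mul, mul_pow, norm_div, h, norm_exp_sq, div_pow, one_pow, P.norm_bog_sq,
    div_mul_eq_mul_div, one_mul, div_mul_eq_mul_div, ← Real.exp_add, gaussExponent]
  congr 2
  rw [Complex.add_re, Complex.add_re, Complex.add_re, ← Complex.ofReal_neg, ← Complex.ofReal_neg,
    Complex.ofReal_re, Complex.ofReal_re]
  ring

theorem Amplifier.G_pos (P : Amplifier) {na nb : ℝ} (ha : 0 < na) (hb : 0 < nb) {x y : ℝ}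
    (hx : 0 ≤ x) (hy : 0 ≤ y) (t : ℝ) : 0 < P.G na nb x y t := by
  rw [P.G_eq]
  positivity

/-- The anomalous term in the exponent of the Husimi function. -/
theorem Amplifier.ℓab_mul_eq (P : Amplifier) {na nb : ℝ} (ha : 0 < na) (hb : 0 < nb) (α β : ℂ)
    (t : ℝ) : starRingEnd ℂ (P.solA t * (starRingEnd ℂ α * starRingEnd ℂ β))
        + P.quadCoeff t * (starRingEnd ℂ (P.linCoeff P.ωa α t)
          * starRingEnd ℂ (P.linCoeff P.ωb β t))
          / (P.G na nb 1 1 t / (na * nb * (1 + ‖P.κ‖ ^ 2 * P.sh t ^ 2)) : ℝ)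
      = P.ℓab na nb t * α * β := by
  have hx := P.bog_ne_zero t
  have hx' : starRingEnd ℂ (P.bog t) ≠ 0 := (map_ne_zero _).mpr hx
  have hG : ((P.G na nb 1 1 t : ℝ) : ℂ) ≠ 0 :=
    Complex.ofReal_ne_zero.mpr (P.G_pos ha hb zero_le_one zero_le_one t).ne'
  have hN : starRingEnd ℂ (P.bog t) * P.bog t = ((1 + ‖P.κ‖ ^ 2 * P.sh t ^ 2 : ℝ) : ℂ) := by
    rw [conj_mul_self_eq, P.norm_bog_sq]
  have hr : ((1 + ‖P.κ‖ ^ 2 * P.sh t ^ 2 : ℝ) : ℂ) ≠ 0 :=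
    Complex.ofReal_ne_zero.mpr (by positivity)
  have hGN : ((P.G na nb 1 1 t : ℝ) : ℂ)
      = na * nb + (na + nb + 1) * ((1 + ‖P.κ‖ ^ 2 * P.sh t ^ 2 : ℝ) : ℂ) := by
    rw [P.G_eq]; push_cast; ring
  have hE : starRingEnd ℂ (Complex.exp (-(Complex.I * (P.ωa + P.δ / 2)) * t))
      * starRingEnd ℂ (Complex.exp (-(Complex.I * (P.ωb + P.δ / 2)) * t))
      = Complex.exp (Complex.I * (P.ωa + P.ωb + P.δ) * t) := by
    rw [← Complex.exp_conj, ← Complex.exp_conj, ← Complex.exp_add]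
    congr 1
    simp only [map_mul, map_neg, map_add, map_div₀, Complex.conj_I, Complex.conj_ofReal, map_ofNat]
    ring
  have hE' : starRingEnd ℂ (Complex.exp (-(Complex.I * P.η) * t))
      = Complex.exp (Complex.I * (P.ωa + P.ωb + P.δ) * t) := by
    rw [← Complex.exp_conj, η]
    congr 1
    simp
  have hna : (na : ℂ) ≠ 0 := Complex.ofReal_ne_zero.mpr ha.ne'
  have hnb : (nb : ℂ) ≠ 0 := Complex.ofReal_ne_zero.mpr hb.ne'
  rw [ℓab, ← P.ofReal_sh, ← P.ofReal_ch, ← bog]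
  rw [solA, quadCoeff, linCoeff, linCoeff]
  simp only [map_mul, map_div₀, map_neg, Complex.conj_I, Complex.conj_conj, Complex.conj_ofReal,
    hE', neg_neg]
  rw [Complex.ofReal_div, Complex.ofReal_mul (na * nb), Complex.ofReal_inv, Complex.ofReal_mul na]
  set E := Complex.exp (Complex.I * (P.ωa + P.ωb + P.δ) * t)
  set Ea := starRingEnd ℂ (Complex.exp (-(Complex.I * (P.ωa + P.δ / 2)) * t))
  set Eb := starRingEnd ℂ (Complex.exp (-(Complex.I * (P.ωb + P.δ / 2)) * t))
  set r := ((1 + ‖P.κ‖ ^ 2 * P.sh t ^ 2 : ℝ) : ℂ)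
  set G := ((P.G na nb 1 1 t : ℝ) : ℂ)
  set x := P.bog t
  set y := starRingEnd ℂ x
  field_simp
  rw [hE, hGN, ← hN]
  ring

/-- The thermal weight turns the coefficients `1`, `1` of the squared moduli into `1 + 1 / na` and
`1 + 1 / nb`; the Gaussian integral then has determinant `G(1,1) / (na nb (1 + N))` with
`N = |κ|² (sinh (φ t) / φ)²`. -/
theorem Amplifier.IsTimeEvolution.husimi_eq {P : Amplifier} {U : ℝ → Fock →L[ℂ] Fock}
    (hU : P.IsTimeEvolution U) {na nb : ℝ} (ha : 0 < na) (hb : 0 < nb) (t : ℝ) (α β : ℂ) :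
    husimi (evolve (U t) (thermalState na nb)) α β = (P.G na nb 1 1 t)⁻¹
      * Real.exp (-(P.ℓb na nb t * ‖α‖ ^ 2 + P.ℓa na nb t * ‖β‖ ^ 2))
      * Real.exp (2 * (P.ℓab na nb t * α * β).re) := by
  rw [husimi_evolve_thermalState ha hb]
  simp only [hU.apply_coherent, P.norm_inner_cohEvol_sq]
  have hG := P.G_pos ha hb zero_le_one zero_le_one t
  set N := ‖P.κ‖ ^ 2 * P.sh t ^ 2 with hN
  have hN0 : 0 ≤ N := by positivity
  have hr : 0 < 1 + N := by positivity
  set g := P.linCoeff P.ωa α t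
  set h := P.linCoeff P.ωb β t
  set e := P.quadCoeff t
  set C := Real.exp (-(‖α‖ ^ 2 + ‖β‖ ^ 2)
          + 2 * (P.solA t * (starRingEnd ℂ α * starRingEnd ℂ β)).re) with hC
  have h1 : ∀ ζ : ℂ × ℂ, Real.exp (-(na⁻¹ * ‖ζ.1‖ ^ 2 + nb⁻¹ * ‖ζ.2‖ ^ 2)) / Real.pi ^ 2
      * (C / (1 + N) * Real.exp (gaussExponent 1 1 g h e (ζ.1, ζ.2)))
      = C / (1 + N) / Real.pi ^ 2
        * Real.exp (gaussExponent (1 + na⁻¹) (1 + nb⁻¹) g h e ζ) := by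
    intro ζ
    have : gaussExponent (1 + na⁻¹) (1 + nb⁻¹) g h e ζ
        = -(na⁻¹ * ‖ζ.1‖ ^ 2 + nb⁻¹ * ‖ζ.2‖ ^ 2) + gaussExponent 1 1 g h e (ζ.1, ζ.2) := by
      simp only [gaussExponent]; ring
    rw [this, Real.exp_add]
    ring
  have he2 : ‖e‖ ^ 2 = N / (1 + N) := P.norm_quadCoeff_sq t
  have hGN : P.G na nb 1 1 t = (na + 1) * (nb + 1) + (na + nb + 1) * N := by
    rw [P.G_eq, mul_one, mul_one]
  have hΔ : (1 + na⁻¹) * (1 + nb⁻¹) - ‖e‖ ^ 2 = P.G na nb 1 1 t / (na * nb * (1 + N)) := by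
    rw [he2, hGN]
    field_simp
    ring
  have hlt : ‖e‖ ^ 2 < (1 + na⁻¹) * (1 + nb⁻¹) := by
    rw [← sub_pos, hΔ]; positivity
  simp only [h1]
  rw [integral_const_mul, integral_gaussExponent (by positivity) hlt, hΔ]
  have hg2 : ‖g‖ ^ 2 = ‖α‖ ^ 2 / (1 + N) := P.norm_linCoeff_sq P.ωa α t
  have hh2 : ‖h‖ ^ 2 = ‖β‖ ^ 2 / (1 + N) := P.norm_linCoeff_sq P.ωb β t
  have hab := congrArg Complex.re (P.ℓab_mul_eq ha hb α β t)
  rw [Complex.add_re, Complex.conj_re, Complex.div_ofReal_re] at hab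
  rw [← hab, hg2, hh2, hC, Amplifier.ℓa, Amplifier.ℓb]
  have hG10 : P.G na nb 1 0 t = na + 1 + (na + nb + 1) * N := by rw [P.G_eq]; ring
  have hG01 : P.G na nb 0 1 t = nb + 1 + (na + nb + 1) * N := by rw [P.G_eq]; ring
  have e3 : ∀ a b c d x y : ℝ, a * (Real.exp x / b / c * (d * Real.exp y))
      = a / b / c * d * Real.exp (x + y) := by
    intro a b c d x y; rw [Real.exp_add]; ring
  rw [e3, mul_assoc (P.G na nb 1 1 t)⁻¹, ← Real.exp_add]
  congr 1
  · field_simp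
  · congr 1
    change _ = -(P.G na nb 0 1 t / P.G na nb 1 1 t * ‖α‖ ^ 2
      + P.G na nb 1 0 t / P.G na nb 1 1 t * ‖β‖ ^ 2) + 2 * (_ + (e * (starRingEnd ℂ g
        * starRingEnd ℂ h)).re / (P.G na nb 1 1 t / (na * nb * (1 + N))))
    rw [hG10, hG01, hGN]
    have hG' : 0 < (na + 1) * (nb + 1) + (na + nb + 1) * N := hGN ▸ hG
    field_simp
    ring

/-! ### Entropy integrals of Gaussians -/

/-- Euler's identity for the Gaussian of a positive quadratic form `q` in real dimension `d`:
differentiating `∫ exp (-s q) = s ^ (-d / 2) ∫ exp (-q)` at `s = 1` gives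
`∫ q exp (-q) = (d / 2) ∫ exp (-q)`. -/
theorem integral_mul_exp_neg_of_homogeneous {E : Type*} [NormedAddCommGroup E] [NormedSpace ℝ E]
    [FiniteDimensional ℝ E] [MeasurableSpace E] [BorelSpace E] (μ : Measure E)
    [μ.IsAddHaarMeasure] {q : E → ℝ} (hq : Continuous q) (h0 : ∀ x, 0 ≤ q x)
    (hhom : ∀ (r : ℝ) (x : E), q (r • x) = r ^ 2 * q x)
    (hi : Integrable (fun x => Real.exp (-q x)) μ) :
    Integrable (fun x => q x * Real.exp (-q x)) μ ∧
      ∫ x, q x * Real.exp (-q x) ∂μ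
        = (Module.finrank ℝ E / 2 : ℝ) * ∫ x, Real.exp (-q x) ∂μ := by
  set F : ℝ → E → ℝ := fun s x => Real.exp (-(s * q x)) with hF
  set F' : ℝ → E → ℝ := fun s x => -(q x * Real.exp (-(s * q x))) with hF'
  -- domination for `s` within `1 / 2` of `1`, from `q ≤ 4 exp (q / 4)`
  have hbi : Integrable (fun x => 4 * Real.exp (-(q x / 4))) μ := by
    have h := (hi.comp_smul (R := (1 / 2 : ℝ)) (by norm_num)).const_mul 4
    refine h.congr (Filter.Eventually.of_forall fun x => ?_)
    simp only [hhom]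
    congr 3
    ring
  have hbound : ∀ x, ∀ s ∈ Metric.ball (1 : ℝ) (1 / 2), ‖F' s x‖ ≤ 4 * Real.exp (-(q x / 4)) := by
    intro x s hs
    rw [Metric.mem_ball, Real.dist_eq, abs_lt] at hs
    have hx := h0 x
    rw [hF', norm_neg, Real.norm_of_nonneg (by positivity)]
    have h1 : q x ≤ 4 * Real.exp (q x / 4) := by linarith [Real.add_one_le_exp (q x / 4)]
    calc _ ≤ 4 * Real.exp (q x / 4) * Real.exp (-(q x / 2)) := by
          gcongr
          nlinarith
      _ = 4 * Real.exp (-(q x / 4)) := by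
          rw [mul_assoc, ← Real.exp_add]
          congr 2
          ring
  have hd := hasDerivAt_integral_of_dominated_loc_of_deriv_le (μ := μ) (F := F) (F' := F')
    (x₀ := (1 : ℝ)) (bound := fun x => 4 * Real.exp (-(q x / 4)))
    (Metric.ball_mem_nhds (1 : ℝ) (by norm_num : (0 : ℝ) < 1 / 2))
    (Filter.Eventually.of_forall fun s => by
      have : Continuous (F s) := by simp only [hF]; fun_prop
      exact this.aestronglyMeasurable)
    (by simpa only [hF, one_mul] using hi)
    (by
      have : Continuous (F' 1) := by simp only [hF']; fun_prop
      exact this.aestronglyMeasurable)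
    (Filter.Eventually.of_forall hbound) hbi
    (Filter.Eventually.of_forall fun x s _ => by
      have := ((hasDerivAt_id' s).mul_const (q x)).fun_neg.exp
      refine this.congr_deriv ?_
      simp only [hF']
      ring)
  have hscale : ∀ s : ℝ, 0 < s →
      ∫ x, F s x ∂μ = s ^ (-(Module.finrank ℝ E / 2 : ℝ)) * ∫ x, Real.exp (-q x) ∂μ := by
    intro s hs
    have h := Measure.integral_comp_smul μ (fun x => Real.exp (-q x)) (√s)
    simp only [hhom, Real.sq_sqrt hs.le] at h
    rw [hF, h, smul_eq_mul, abs_of_nonneg (by positivity), Real.sqrt_eq_rpow, ← Real.rpow_natCast,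
      ← Real.rpow_mul hs.le, ← Real.rpow_neg hs.le]
    congr 2
    ring
  have hd2 : HasDerivAt (fun s => ∫ x, F s x ∂μ)
      (-(Module.finrank ℝ E / 2 : ℝ) * ∫ x, Real.exp (-q x) ∂μ) 1 := by
    have h := (Real.hasDerivAt_rpow_const (x := 1) (p := -(Module.finrank ℝ E / 2 : ℝ))
      (Or.inl one_ne_zero)).mul_const (∫ x, Real.exp (-q x) ∂μ)
    rw [Real.one_rpow, mul_one] at h
    refine h.congr_of_eventuallyEq ?_
    filter_upwards [lt_mem_nhds (zero_lt_one' ℝ)] with s hs using hscale s hs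
  have h1 := hd.1.neg
  have h2 := hd.2.unique hd2
  simp only [hF', one_mul] at h1 h2
  refine ⟨by simpa only [Pi.neg_def, neg_neg] using h1, ?_⟩
  rw [integral_neg] at h2
  linarith

/-- The integral of `Q log Q` for a Gaussian density `Q = c exp (-q)`. -/
theorem entropy_of_homogeneous {E : Type*} [NormedAddCommGroup E] [NormedSpace ℝ E]
    [FiniteDimensional ℝ E] [MeasurableSpace E] [BorelSpace E] (μ : Measure E)
    [μ.IsAddHaarMeasure] {q : E → ℝ} (hq : Continuous q) (h0 : ∀ x, 0 ≤ q x)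
    (hhom : ∀ (r : ℝ) (x : E), q (r • x) = r ^ 2 * q x)
    (hi : Integrable (fun x => Real.exp (-q x)) μ) {c : ℝ} (hc : 0 < c) :
    Integrable (fun x => c * Real.exp (-q x) * Real.log (c * Real.exp (-q x))) μ ∧
      ∫ x, c * Real.exp (-q x) * Real.log (c * Real.exp (-q x)) ∂μ
        = (Real.log c - Module.finrank ℝ E / 2) * (c * ∫ x, Real.exp (-q x) ∂μ) := by
  obtain ⟨h1, h2⟩ := integral_mul_exp_neg_of_homogeneous μ hq h0 hhom hi
  have e : ∀ x, c * Real.exp (-q x) * Real.log (c * Real.exp (-q x))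
      = c * Real.log c * Real.exp (-q x) - c * (q x * Real.exp (-q x)) := by
    intro x
    rw [Real.log_mul hc.ne' (Real.exp_ne_zero _), Real.log_exp]
    ring
  simp only [e]
  refine ⟨(hi.const_mul _).sub (h1.const_mul _), ?_⟩
  rw [integral_sub (hi.const_mul _) (h1.const_mul _), integral_const_mul, integral_const_mul, h2]
  ring

theorem entropy_thermal {G : ℝ} (hG : 0 < G) :
    Integrable (fun z : ℂ => G⁻¹ * Real.exp (-(G⁻¹ * ‖z‖ ^ 2))
        * Real.log (G⁻¹ * Real.exp (-(G⁻¹ * ‖z‖ ^ 2)))) ∧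
      partialEntropy (fun z : ℂ => G⁻¹ * Real.exp (-(G⁻¹ * ‖z‖ ^ 2))) = 1 + Real.log G := by
  have hG' : 0 < G⁻¹ := inv_pos.mpr hG
  have hi := integrable_gaussian hG' 0
  have hv := integral_gaussian_complex hG' 0
  simp only [zero_mul, Complex.zero_re, mul_zero, add_zero, norm_zero, ne_eq, OfNat.ofNat_ne_zero,
    not_false_eq_true, zero_pow, zero_div, Real.exp_zero, mul_one] at hi hv
  obtain ⟨h1, h2⟩ := entropy_of_homogeneous (volume : Measure ℂ)
    (q := fun z => G⁻¹ * ‖z‖ ^ 2) (by fun_prop) (fun z => by positivity)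
    (fun r z => by rw [norm_smul, mul_pow, Real.norm_eq_abs, sq_abs]; ring) hi hG'
  refine ⟨h1, ?_⟩
  rw [partialEntropy, integral_div, h2, hv, Complex.finrank_real_complex, Real.log_inv]
  have := Real.pi_pos
  push_cast
  field_simp
  ring

theorem neg_gaussExponent_nonneg {p q : ℝ} {e : ℂ} (hq : 0 < q) (he : ‖e‖ ^ 2 < p * q)
    (z : ℂ × ℂ) : 0 ≤ -gaussExponent p q 0 0 e z := by
  have h1 : (e * (z.1 * z.2)).re ≤ ‖e‖ * (‖z.1‖ * ‖z.2‖) :=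
    (Complex.re_le_norm _).trans_eq (by rw [norm_mul, norm_mul])
  have h2 : 0 ≤ q * (p * ‖z.1‖ ^ 2 + q * ‖z.2‖ ^ 2 - 2 * (‖e‖ * (‖z.1‖ * ‖z.2‖))) := by
    have : q * (p * ‖z.1‖ ^ 2 + q * ‖z.2‖ ^ 2 - 2 * (‖e‖ * (‖z.1‖ * ‖z.2‖)))
        = (q * ‖z.2‖ - ‖e‖ * ‖z.1‖) ^ 2 + (p * q - ‖e‖ ^ 2) * ‖z.1‖ ^ 2 := by ring
    rw [this]
    have := sub_pos.mpr he
    positivity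
  have h3 := nonneg_of_mul_nonneg_right h2 hq
  simp only [gaussExponent, zero_mul, zero_add]
  linarith

theorem entropy_gaussExponent {p q G : ℝ} {e : ℂ} (hq : 0 < q) (hG : 0 < G)
    (he : p * q - ‖e‖ ^ 2 = G⁻¹) :
    Integrable (fun z : ℂ × ℂ => G⁻¹ * Real.exp (gaussExponent p q 0 0 e z)
        * Real.log (G⁻¹ * Real.exp (gaussExponent p q 0 0 e z))) ∧
      (∫ z : ℂ × ℂ, G⁻¹ * Real.exp (gaussExponent p q 0 0 e z)
        * Real.log (G⁻¹ * Real.exp (gaussExponent p q 0 0 e z)))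
        = -(2 + Real.log G) * Real.pi ^ 2 := by
  have hG' : 0 < G⁻¹ := inv_pos.mpr hG
  have he' : ‖e‖ ^ 2 < p * q := by linarith
  have hi := integrable_gaussExponent hq he' 0 0
  have hv := integral_gaussExponent hq he' 0 0
  rw [he] at hv
  have hc : Continuous fun z => -gaussExponent p q 0 0 e z :=
    (continuous_gaussExponent p q 0 0 e).neg
  have hhom : ∀ (r : ℝ) (z : ℂ × ℂ), -gaussExponent p q 0 0 e (r • z)
      = r ^ 2 * -gaussExponent p q 0 0 e z := by
    intro r z
    have h1 : e * (((r : ℂ) * z.1) * ((r : ℂ) * z.2))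
        = ((r ^ 2 : ℝ) : ℂ) * (e * (z.1 * z.2)) := by push_cast; ring
    simp only [gaussExponent, Prod.smul_fst, Prod.smul_snd, zero_mul, zero_add,
      Complex.real_smul, h1, Complex.re_ofReal_mul, norm_mul, Complex.norm_real, Real.norm_eq_abs,
      mul_pow, sq_abs]
    ring
  have : (volume : Measure (ℂ × ℂ)).IsAddHaarMeasure := by
    rw [Measure.volume_eq_prod]
    infer_instance
  have h := entropy_of_homogeneous (volume : Measure (ℂ × ℂ)) hc (neg_gaussExponent_nonneg hq he')
    hhom (by simpa only [neg_neg] using hi) hG'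
  simp only [neg_neg] at h
  refine ⟨h.1, ?_⟩
  rw [h.2, hv, Module.finrank_prod, Complex.finrank_real_complex, Real.log_inv]
  simp only [norm_zero, map_zero, mul_zero, Complex.zero_re, add_zero, ne_eq, OfNat.ofNat_ne_zero,
    not_false_eq_true, zero_pow, zero_div, Real.exp_zero, mul_one]
  push_cast
  field_simp
  ring

/-! ### Marginals and entropies of the Husimi function -/

theorem Amplifier.norm_ℓab_sq (P : Amplifier) {na nb : ℝ} (ha : 0 < na) (hb : 0 < nb) (t : ℝ) :
    ‖P.ℓab na nb t‖ ^ 2 = (na + nb + 1) ^ 2 * (‖P.κ‖ ^ 2 * P.sh t ^ 2)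
      * (1 + ‖P.κ‖ ^ 2 * P.sh t ^ 2) / P.G na nb 1 1 t ^ 2 := by
  have h1 : ‖Complex.exp (Complex.I * (P.ωa + P.ωb + P.δ) * t)‖ = 1 := by
    rw [show Complex.I * (P.ωa + P.ωb + P.δ) * t
      = (((P.ωa + P.ωb + P.δ) * t : ℝ) : ℂ) * Complex.I by push_cast; ring,
      Complex.norm_exp_ofReal_mul_I]
  have h2 : ‖(na + nb + 1 : ℂ)‖ = na + nb + 1 := by
    rw [show (na + nb + 1 : ℂ) = ((na + nb + 1 : ℝ) : ℂ) by push_cast; ring, Complex.norm_real,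
      Real.norm_of_nonneg (by positivity)]
  rw [ℓab, ← P.ofReal_sh, ← P.ofReal_ch, ← bog]
  simp only [norm_mul, h1, h2, Complex.norm_I, Complex.norm_real, mul_pow, P.norm_bog_sq,
    Real.norm_eq_abs, sq_abs]
  ring

/-- The determinant of the quadratic form in the exponent of the Husimi function. -/
theorem Amplifier.ℓb_mul_ℓa_sub (P : Amplifier) {na nb : ℝ} (ha : 0 < na) (hb : 0 < nb) (t : ℝ) :
    P.ℓb na nb t * P.ℓa na nb t - ‖P.ℓab na nb t‖ ^ 2 = (P.G na nb 1 1 t)⁻¹ := by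
  have hG := P.G_pos ha hb zero_le_one zero_le_one t
  rw [P.norm_ℓab_sq ha hb, ℓa, ℓb]
  field_simp
  simp only [P.G_eq]
  ring

theorem Amplifier.ℓa_pos (P : Amplifier) {na nb : ℝ} (ha : 0 < na) (hb : 0 < nb) (t : ℝ) :
    0 < P.ℓa na nb t :=
  div_pos (P.G_pos ha hb zero_le_one le_rfl t) (P.G_pos ha hb zero_le_one zero_le_one t)

theorem Amplifier.ℓb_pos (P : Amplifier) {na nb : ℝ} (ha : 0 < na) (hb : 0 < nb) (t : ℝ) :
    0 < P.ℓb na nb t :=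
  div_pos (P.G_pos ha hb le_rfl zero_le_one t) (P.G_pos ha hb zero_le_one zero_le_one t)

theorem gaussExponent_swap (p q : ℝ) (e x y : ℂ) :
    gaussExponent p q 0 0 e (x, y) = gaussExponent q p 0 0 e (y, x) := by
  simp only [gaussExponent, zero_mul, zero_add, mul_comm y x]
  ring

/-- A marginal of a normalized Gaussian Husimi function, where `q = K / G` and `G⁻¹` is the
determinant of the quadratic form. -/
theorem integral_gaussExponent_div_pi {p q G K : ℝ} {e : ℂ} (hq : 0 < q) (hG : 0 < G)
    (hK : q = K / G) (he : p * q - ‖e‖ ^ 2 = G⁻¹) (x : ℂ) :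
    Integrable (fun y : ℂ => G⁻¹ * Real.exp (gaussExponent p q 0 0 e (x, y))) ∧
      ∫ y : ℂ, G⁻¹ * Real.exp (gaussExponent p q 0 0 e (x, y)) / Real.pi
        = K⁻¹ * Real.exp (-(K⁻¹ * ‖x‖ ^ 2)) := by
  constructor
  · simp only [exp_gaussExponent]
    exact ((integrable_gaussian hq _).const_mul _).const_mul _
  · have hKpos : 0 < K := by
      have := mul_pos hq hG
      rwa [hK, div_mul_cancel₀ _ hG.ne'] at this
    rw [integral_div, integral_const_mul, integral_gaussExponent_fiber p hq]
    have e1 : p - ‖e‖ ^ 2 / q = K⁻¹ := by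
      have : p - ‖e‖ ^ 2 / q = (p * q - ‖e‖ ^ 2) / q := by field_simp
      rw [this, he, hK]
      field_simp
    rw [e1]
    simp only [norm_zero, map_zero, zero_mul, mul_zero, Complex.zero_re, add_zero, ne_eq,
      OfNat.ofNat_ne_zero, not_false_eq_true, zero_pow, zero_div, Real.exp_zero, mul_one]
    rw [hK]
    have := Real.pi_pos
    field_simp

/-- `G(1,0) G(0,1)` exceeds `G(1,1)` by the squared modulus of the anomalous correlation. -/
theorem Amplifier.G_mul_G (P : Amplifier) (na nb t : ℝ) :
    P.G na nb 1 0 t * P.G na nb 0 1 t = P.G na nb 1 1 t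
      + (na + nb + 1) ^ 2 * (‖P.κ‖ ^ 2 * P.sh t ^ 2) * (1 + ‖P.κ‖ ^ 2 * P.sh t ^ 2) := by
  simp only [P.G_eq]
  ring

end ParamAmp

/-! ### Husimi functions and Wehrl entropies of the amplifier -/

theorem mainTheorem5 (P : ParamAmp.Amplifier) :
    (∃! U : ℝ → ParamAmp.Fock →L[ℂ] ParamAmp.Fock, P.IsTimeEvolution U) ∧
    ∀ U : ℝ → ParamAmp.Fock →L[ℂ] ParamAmp.Fock, P.IsTimeEvolution U →
    ∀ na nb : ℝ, 0 < na → 0 < nb →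
    ∀ Q : ℝ → ℂ → ℂ → ℝ,
      (∀ t, Q t = ParamAmp.husimi (ParamAmp.evolve (U t) (ParamAmp.thermalState na nb))) →
      (∀ t : ℝ,
        -- the joint Husimi function
        (∀ α β : ℂ, Q t α β = (P.G na nb 1 1 t)⁻¹
          * Real.exp (-(P.ℓb na nb t * ‖α‖ ^ 2 + P.ℓa na nb t * ‖β‖ ^ 2))
          * Real.exp (2 * (P.ℓab na nb t * α * β).re)) ∧
        -- the marginal Husimi functions
        (∀ α : ℂ, Integrable (fun β : ℂ => Q t α β) ∧
          ParamAmp.marginalA (Q t) α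
            = (P.G na nb 1 0 t)⁻¹ * Real.exp (-((P.G na nb 1 0 t)⁻¹ * ‖α‖ ^ 2))) ∧
        (∀ β : ℂ, Integrable (fun α : ℂ => Q t α β) ∧
          ParamAmp.marginalB (Q t) β
            = (P.G na nb 0 1 t)⁻¹ * Real.exp (-((P.G na nb 0 1 t)⁻¹ * ‖β‖ ^ 2))) ∧
        -- the joint entropy
        Integrable (fun z : ℂ × ℂ => Q t z.1 z.2 * Real.log (Q t z.1 z.2)) ∧
        ParamAmp.jointEntropy (Q t) = 2 + Real.log (P.G na nb 1 1 t) ∧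
        -- the partial entropies
        Integrable (fun α : ℂ =>
          ParamAmp.marginalA (Q t) α * Real.log (ParamAmp.marginalA (Q t) α)) ∧
        ParamAmp.partialEntropy (ParamAmp.marginalA (Q t)) = 1 + Real.log (P.G na nb 1 0 t) ∧
        Integrable (fun β : ℂ =>
          ParamAmp.marginalB (Q t) β * Real.log (ParamAmp.marginalB (Q t) β)) ∧
        ParamAmp.partialEntropy (ParamAmp.marginalB (Q t)) = 1 + Real.log (P.G na nb 0 1 t) ∧
        -- subadditivity
        ParamAmp.jointEntropy (Q t) ≤ ParamAmp.partialEntropy (ParamAmp.marginalA (Q t))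
          + ParamAmp.partialEntropy (ParamAmp.marginalB (Q t))) ∧
      -- equality and factorization at time zero
      ParamAmp.jointEntropy (Q 0) = ParamAmp.partialEntropy (ParamAmp.marginalA (Q 0))
        + ParamAmp.partialEntropy (ParamAmp.marginalB (Q 0)) ∧
      (∀ α β : ℂ, Q 0 α β = ParamAmp.marginalA (Q 0) α * ParamAmp.marginalB (Q 0) β) := by
  refine ⟨P.existsUnique_isTimeEvolution, fun U hU na nb ha hb Q hQ => ?_⟩
  have hQ' : ∀ t α β, Q t α β = (P.G na nb 1 1 t)⁻¹
      * Real.exp (-(P.ℓb na nb t * ‖α‖ ^ 2 + P.ℓa na nb t * ‖β‖ ^ 2))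
      * Real.exp (2 * (P.ℓab na nb t * α * β).re) := fun t α β => by
    rw [hQ, hU.husimi_eq ha hb]
  have hQg : ∀ t α β, Q t α β = (P.G na nb 1 1 t)⁻¹ * Real.exp (ParamAmp.gaussExponent
      (P.ℓb na nb t) (P.ℓa na nb t) 0 0 (P.ℓab na nb t) (α, β)) := fun t α β => by
    rw [hQ', mul_assoc, ← Real.exp_add, ParamAmp.gaussExponent]
    simp only [zero_mul, zero_add, mul_assoc]
  have hG11 := fun t => P.G_pos ha hb zero_le_one zero_le_one t
  have hG10 := fun t => P.G_pos ha hb zero_le_one le_rfl t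
  have hG01 := fun t => P.G_pos ha hb le_rfl zero_le_one t
  have hA : ∀ t α, Integrable (fun β : ℂ => Q t α β) ∧ ParamAmp.marginalA (Q t) α
      = (P.G na nb 1 0 t)⁻¹ * Real.exp (-((P.G na nb 1 0 t)⁻¹ * ‖α‖ ^ 2)) := fun t α => by
    simp only [ParamAmp.marginalA, hQg]
    exact ParamAmp.integral_gaussExponent_div_pi (P.ℓa_pos ha hb t) (hG11 t) rfl
      (P.ℓb_mul_ℓa_sub ha hb t) α
  have hB : ∀ t β, Integrable (fun α : ℂ => Q t α β) ∧ ParamAmp.marginalB (Q t) β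
      = (P.G na nb 0 1 t)⁻¹ * Real.exp (-((P.G na nb 0 1 t)⁻¹ * ‖β‖ ^ 2)) := fun t β => by
    simp only [ParamAmp.marginalB, hQg, ParamAmp.gaussExponent_swap (P.ℓb na nb t)]
    exact ParamAmp.integral_gaussExponent_div_pi (P.ℓb_pos ha hb t) (hG11 t) rfl
      (by rw [mul_comm, P.ℓb_mul_ℓa_sub ha hb t]) β
  have hJ : ∀ t, Integrable (fun z : ℂ × ℂ => Q t z.1 z.2 * Real.log (Q t z.1 z.2)) ∧
      ParamAmp.jointEntropy (Q t) = 2 + Real.log (P.G na nb 1 1 t) := fun t => by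
    obtain ⟨h1, h2⟩ := ParamAmp.entropy_gaussExponent (P.ℓa_pos ha hb t) (hG11 t)
      (P.ℓb_mul_ℓa_sub ha hb t)
    simp only [ParamAmp.jointEntropy, hQg]
    refine ⟨h1, ?_⟩
    rw [integral_div, h2]
    have := Real.pi_pos
    field_simp
  have hEA : ∀ t, Integrable (fun α : ℂ =>
        ParamAmp.marginalA (Q t) α * Real.log (ParamAmp.marginalA (Q t) α)) ∧
      ParamAmp.partialEntropy (ParamAmp.marginalA (Q t)) = 1 + Real.log (P.G na nb 1 0 t) :=
    fun t => by
      rw [show ParamAmp.marginalA (Q t) = _ from funext fun α => (hA t α).2]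
      exact ParamAmp.entropy_thermal (hG10 t)
  have hEB : ∀ t, Integrable (fun β : ℂ =>
        ParamAmp.marginalB (Q t) β * Real.log (ParamAmp.marginalB (Q t) β)) ∧
      ParamAmp.partialEntropy (ParamAmp.marginalB (Q t)) = 1 + Real.log (P.G na nb 0 1 t) :=
    fun t => by
      rw [show ParamAmp.marginalB (Q t) = _ from funext fun β => (hB t β).2]
      exact ParamAmp.entropy_thermal (hG01 t)
  have hG0 : P.G na nb 1 1 0 = P.G na nb 1 0 0 * P.G na nb 0 1 0 := by
    rw [P.G_mul_G, P.sh_zero]; ring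
  refine ⟨fun t => ⟨hQ' t, hA t, hB t, (hJ t).1, (hJ t).2, (hEA t).1, (hEA t).2, (hEB t).1,
    (hEB t).2, ?_⟩, ?_, fun α β => ?_⟩
  · rw [(hJ t).2, (hEA t).2, (hEB t).2]
    have h1 : P.G na nb 1 1 t ≤ P.G na nb 1 0 t * P.G na nb 0 1 t := by
      rw [P.G_mul_G]
      exact le_add_of_nonneg_right (by positivity)
    have h2 := Real.log_le_log (hG11 t) h1
    rw [Real.log_mul (hG10 t).ne' (hG01 t).ne'] at h2
    linarith
  · rw [(hJ 0).2, (hEA 0).2, (hEB 0).2, hG0, Real.log_mul (hG10 0).ne' (hG01 0).ne']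
    ring
  · have hab : P.ℓab na nb 0 = 0 := by
      rw [ParamAmp.Amplifier.ℓab, ← P.ofReal_sh, P.sh_zero]
      simp
    have e1 : P.ℓb na nb 0 = (P.G na nb 1 0 0)⁻¹ := by
      rw [ParamAmp.Amplifier.ℓb, hG0, div_mul_cancel_right₀ (hG01 0).ne']
    have e2 : P.ℓa na nb 0 = (P.G na nb 0 1 0)⁻¹ := by
      rw [ParamAmp.Amplifier.ℓa, hG0, div_mul_cancel_left₀ (hG10 0).ne']
    rw [hQ', (hA 0 α).2, (hB 0 β).2, hab, e1, e2, hG0, neg_add, Real.exp_add, mul_inv]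
    simp only [zero_mul, Complex.zero_re, mul_zero, Real.exp_zero, mul_one]
    ring
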